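/- Let $\mathcal L(\mathbb Z^2)$ be the square lattice graph (vertex set $\mathbb Z^2$, two vertices adjacent when they are at distance $1$). A subgraph $G$ of $\mathcal L(\mathbb Z^2)$ is called a simple grid graph if it consists of exactly the vertices and edges of $\mathcal L(\mathbb Z^2)$ that lie on or interior to a simple closed loop (a cycle) $\alpha$ of $\mathcal L(\mathbb Z^2)$; $\mathrm{Area}(G)$ denotes its number of faces, i.e. the number of unit lattice squares all four sides of which are edges of $G$, and $\tau(G)$ denotes its number of spanning trees. Let $G$ be a simple grid graph, let $\{V_1,\dots,V_K\}$ be a partition of its vertex set, let $G_i$ be the subgraph of $G$ induced by $V_i$, and assume that each $G_i$ is a simple grid graph. Let $\mathcal C$ be the set of cut edges, i.e. the edges of $G$ joining vertices that belong to different sets $V_i$. Then $$|\mathcal C| = C_1-\sum_{i=1}^K \mathrm{Area}(G_i),\qquad C_1=\mathrm{Area}(G)+K-1 .$$ Moreover, with $\mathfrak b=\exp(4C/\pi)$, where $C=\sum_{n\ge 0}(-1)^n/(2n+1)^2$ is Catalan's constant, $$C_1-\frac{1}{\ln \mathfrak b}\,\ln\Big(\prod_{i=1}^K\tau(G_i)\Big)\;\le\;|\mathcal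 C|\;\le\; C_1-\frac{1}{\ln 4}\,\ln\Big(\prod_{i=1}^K\tau(G_i)\Big).$$ -/

import Mathlib

open scoped BigOperators

noncomputable section

/-- The regular square lattice: vertex set `ℤ × ℤ`, rook-adjacent edges. -/
def squareLattice : SimpleGraph (ℤ × ℤ) where
  Adj p q := |p.1 - q.1| + |p.2 - q.2| = 1
  symm := ⟨fun p q h => by rw [abs_sub_comm q.1, abs_sub_comm q.2]; exact h⟩
  loopless := ⟨fun p h => by simp at h⟩

/-- The lattice point `p`, as a point of the plane. -/
def latticePoint (p : ℤ × ℤ) : ℝ × ℝ := ((p.1 : ℝ), (p.2 : ℝ))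

/-- The closed polygonal curve in the plane traced by a closed walk in the lattice: the union of
the segments spanned by its edges. -/
def loopTrace {v : ℤ × ℤ} (α : squareLattice.Walk v v) : Set (ℝ × ℝ) :=
  {x | ∃ p q : ℤ × ℤ, s(p, q) ∈ α.edges ∧ x ∈ segment ℝ (latticePoint p) (latticePoint q)}

/-- The interior of a loop: the points off the loop whose connected component in the complement
of the loop is bounded. -/
def loopInterior {v : ℤ × ℤ} (α : squareLattice.Walk v v) : Set (ℝ × ℝ) :=
  {x | x ∉ loopTrace α ∧ Bornology.IsBounded (connectedComponentIn (loopTrace α)ᶜ x)}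

/-- The region on and interior to a loop. -/
def loopRegion {v : ℤ × ℤ} (α : squareLattice.Walk v v) : Set (ℝ × ℝ) :=
  loopTrace α ∪ loopInterior α

/-- A subgraph of the square lattice is a *simple grid graph* if its vertices and edges are exactly
the lattice vertices and lattice edges that lie on or interior to a simple closed loop (a cycle of
the lattice). An edge lies there if the whole segment between its endpoints does. -/
def IsSimpleGridGraph (G : squareLattice.Subgraph) : Prop :=
  ∃ (v : ℤ × ℤ) (α : squareLattice.Walk v v), α.IsCycle ∧
    (∀ p, p ∈ G.verts ↔ latticePoint p ∈ loopRegion α) ∧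
    (∀ p q, G.Adj p q ↔
      squareLattice.Adj p q ∧ segment ℝ (latticePoint p) (latticePoint q) ⊆ loopRegion α)

/-- The faces of `G`, each recorded by its bottom-left corner: the unit squares of the lattice all
four sides of which are edges of `G`. -/
def gridFaces (G : squareLattice.Subgraph) : Set (ℤ × ℤ) :=
  {p | G.Adj p (p.1 + 1, p.2) ∧ G.Adj (p.1 + 1, p.2) (p.1 + 1, p.2 + 1) ∧
    G.Adj (p.1, p.2 + 1) (p.1 + 1, p.2 + 1) ∧ G.Adj p (p.1, p.2 + 1)}

/-- The area of `G`: its number of faces. -/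
def gridArea (G : squareLattice.Subgraph) : ℕ := (gridFaces G).ncard

/-- The cut edges: the edges of `G` between vertices that belong to different districts. -/
def cutEdges (G : squareLattice.Subgraph) {K : ℕ} (V : Fin K → Set (ℤ × ℤ)) :
    Set (Sym2 (ℤ × ℤ)) :=
  {e | e ∈ G.edgeSet ∧ ∃ i j : Fin K, i ≠ j ∧ ∃ p ∈ V i, ∃ q ∈ V j, e = s(p, q)}

/-- The number of spanning trees of `G`, that is, of trees on the whole vertex set of `G` all of
whose edges are edges of `G`. -/
def numSpanningTrees (G : squareLattice.Subgraph) : ℕ :=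
  {T : SimpleGraph G.verts | T ≤ G.coe ∧ T.IsTree}.ncard

/-- Catalan's constant `1 - 1/9 + 1/25 - 1/49 + ⋯` (an absolutely convergent series). -/
def catalanC : ℝ := ∑' n : ℕ, (-1 : ℝ) ^ n / (2 * (n : ℝ) + 1) ^ 2

/-- The base `exp (4C/π) ≈ 3.2099`. -/
def bulkBase : ℝ := Real.exp (4 * catalanC / Real.pi)

end

/-! Every simple grid graph satisfies Euler's formula, faces + vertices = edges + 1. Summing it over
the districts and comparing with the formula for `G` gives the identity for the cut edges, since the
districts partition the vertices and miss exactly the cut edges. Both inequalities then follow from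
a bound for each district: Area · ln b ≤ ln τ ≤ Area · ln 4.

Euler's formula and a determinant for τ come from one fact: the boundaries of the unit faces form a
basis of the lattice of integer flows. By Cauchy–Binet, τ = det(M Mᵀ) for the matrix M of face
boundaries, because a maximal minor of M is ±1 when the complementary edges form a spanning tree and
0 otherwise. A face has four sides and two neighbouring faces share one side with opposite signs, so
M Mᵀ = 4 − A with A the adjacency matrix of the faces. The Jordan curve theorem is not needed: a
flow has a finitely supported potential on all squares of the plane, and this potential is locally
constant off the loop region, hence zero on the unbounded components there.

A maximum principle puts the eigenvalues of A in (−4, 4). The upper bound is log(1 − x) ≤ −x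
together with tr A = 0. For the lower bound, expand log det(1 − A/4) = −∑ tr(A/4)^k / k. The entry
(A^k) p p counts closed walks inside the region, hence is at most the number (2^k m_k)² of closed
k-step walks on ℤ², where m_k is the mean of cos^k. It remains to prove ∑ m_k² / k ≤ log 4 − 4C/π,
which comes from the generating function of m_k and the integral of log(2 cos u) over [0, π/4]. -/

set_option linter.unusedSectionVars false

/-! ### Cauchy–Binet -/

namespace Matrix

/-- The Cauchy–Binet formula, in the form of a sum over all maps of index sets. -/
theorem factorial_mul_det_mul {m n R : Type*} [Fintype m] [DecidableEq m] [Fintype n]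
    [CommRing R] (M : Matrix m n R) (N : Matrix n m R) :
    ((Fintype.card m).factorial : R) * (M * N).det =
      ∑ f : m → n, (M.submatrix id f).det * (N.submatrix f id).det := by
  classical
  have key : (M * N).det = ∑ f : m → n, (∏ i, M i (f i)) * (N.submatrix f id).det := by
    have h1 : (M * N) = fun i => ∑ k, M i k • N k := by
      ext i j
      simp [Matrix.mul_apply]
    rw [h1]
    refine ((detRowAlternating (R := R) (n := m)).toMultilinearMap.map_sum _).trans ?_
    refine Finset.sum_congr rfl fun f _ => ?_
    exact (detRowAlternating (R := R) (n := m)).toMultilinearMap.map_smul_univ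
      (fun i => M i (f i)) (fun i => N (f i))
  -- Reindexing the sum by `f ↦ f ∘ σ` costs sign σ in the second determinant. Adding this up over
  -- all σ assembles the determinant of the columns of `M` and accounts for the factorial.
  have perm : ∀ σ : Equiv.Perm m, (M * N).det =
      ∑ f : m → n, ((Equiv.Perm.sign σ : ℤ) : R) * (∏ i, M i (f (σ i))) *
        (N.submatrix f id).det := by
    intro σ
    rw [key]
    symm
    refine Fintype.sum_equiv (Equiv.arrowCongr σ.symm (Equiv.refl n)) _ _ fun f => ?_
    have h3 : (N.submatrix (fun i => f (σ i)) id).det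
        = ((Equiv.Perm.sign σ : ℤ) : R) * (N.submatrix f id).det :=
      det_permute σ (N.submatrix f id)
    change _ = (∏ i, M i (f (σ i))) * (N.submatrix (fun i => f (σ i)) id).det
    rw [h3]
    ring
  have hsum : ∑ _σ : Equiv.Perm m, (M * N).det =
      ((Fintype.card m).factorial : R) * (M * N).det := by
    simp [Fintype.card_perm]
  rw [← hsum, Finset.sum_congr rfl fun σ _ => perm σ, Finset.sum_comm]
  refine Finset.sum_congr rfl fun f _ => ?_
  rw [← Finset.sum_mul, ← det_transpose (M.submatrix id f), det_apply' (M.submatrix id f)ᵀ]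
  rfl

end Matrix

/-! ### Integer flows, Euler's formula and spanning trees of a graph with a basis of flows -/

namespace EdgeParam

variable {V E F : Type*} (s t : E → V)

/-- The graph with the edges `s e — t e` for `e ∈ S`. -/
def edgeGraph (S : Set E) : SimpleGraph V :=
  SimpleGraph.fromEdgeSet ((fun e => s(s e, t e)) '' S)

variable {s t}

theorem edgeGraph_adj (hne : ∀ e, s e ≠ t e) {S : Set E} {u v : V} :
    (edgeGraph s t S).Adj u v ↔ ∃ e ∈ S, (s e = u ∧ t e = v) ∨ (s e = v ∧ t e = u) := by
  simp only [edgeGraph, SimpleGraph.fromEdgeSet_adj, Set.mem_image, Sym2.eq_iff]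
  constructor
  · rintro ⟨h, -⟩
    exact h
  · rintro ⟨e, he, h⟩
    refine ⟨⟨e, he, h⟩, ?_⟩
    rcases h with ⟨rfl, rfl⟩ | ⟨rfl, rfl⟩
    · exact hne e
    · exact (hne e).symm

theorem edgeGraph_adj_of_mem (hne : ∀ e, s e ≠ t e) {S : Set E} {e : E} (he : e ∈ S) :
    (edgeGraph s t S).Adj (s e) (t e) :=
  (edgeGraph_adj hne).2 ⟨e, he, Or.inl ⟨rfl, rfl⟩⟩

theorem edgeSet_edgeGraph (hne : ∀ e, s e ≠ t e) (S : Set E) :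
    (edgeGraph s t S).edgeSet = (fun e => s(s e, t e)) '' S := by
  rw [edgeGraph, SimpleGraph.edgeSet_fromEdgeSet, sdiff_eq_left]
  rw [Set.disjoint_left]
  rintro _ ⟨e, -, rfl⟩ h
  exact hne e (by simpa using h)

theorem edgeGraph_injective (hinj : Function.Injective fun e => s(s e, t e))
    (hne : ∀ e, s e ≠ t e) : Function.Injective (edgeGraph s t) := by
  intro S S' h
  have := congrArg SimpleGraph.edgeSet h
  rw [edgeSet_edgeGraph hne, edgeSet_edgeGraph hne] at this
  exact (Set.image_injective.2 hinj) this

theorem exists_eq_edgeGraph (hne : ∀ e, s e ≠ t e) {T : SimpleGraph V}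
    (hT : T ≤ edgeGraph s t Set.univ) : ∃ S, T = edgeGraph s t S := by
  refine ⟨{e | T.Adj (s e) (t e)}, ?_⟩
  ext u v
  rw [edgeGraph_adj hne]
  constructor
  · intro h
    obtain ⟨e, -, he⟩ := (edgeGraph_adj hne).1 (hT h)
    refine ⟨e, ?_, he⟩
    rcases he with ⟨rfl, rfl⟩ | ⟨rfl, rfl⟩
    · exact h
    · exact h.symm
  · rintro ⟨e, he, ⟨rfl, rfl⟩ | ⟨rfl, rfl⟩⟩
    · exact he
    · exact SimpleGraph.Adj.symm he

variable [DecidableEq V] [Fintype E]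

variable (s t) in
/-- The net flow of `z` into the vertex `v`. -/
def inflow (z : E → ℤ) (v : V) : ℤ :=
  ∑ e, z e * ((if t e = v then 1 else 0) - (if s e = v then 1 else 0))

theorem inflow_add (z z' : E → ℤ) (v : V) :
    inflow s t (z + z') v = inflow s t z v + inflow s t z' v := by
  simp [inflow, add_mul, Finset.sum_add_distrib]

theorem inflow_neg (z : E → ℤ) (v : V) : inflow s t (-z) v = -inflow s t z v := by
  simp [inflow]

theorem inflow_single [DecidableEq E] (e : E) (v : V) :
    inflow s t (Pi.single e 1) v = (if t e = v then 1 else 0) - (if s e = v then 1 else 0) := by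
  simp [inflow, Pi.single_apply]

/-- Summation by parts: flows are orthogonal to differences of potentials. -/
theorem sum_flow_mul_diff [Fintype V] {z : E → ℤ} (hz : ∀ v, inflow s t z v = 0) (φ : V → ℤ) :
    ∑ e, z e * (φ (t e) - φ (s e)) = 0 := by
  have : ∑ v, inflow s t z v * φ v = 0 := by simp [hz]
  simp only [inflow, Finset.sum_mul] at this
  rw [Finset.sum_comm] at this
  rw [← this]
  refine Finset.sum_congr rfl fun e _ => ?_
  simp [mul_assoc, ← Finset.mul_sum, sub_mul]

/-- Send one unit along a walk, adding ±1 on each edge traversed according to its orientation. -/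
theorem exists_unit_flow (hne : ∀ e, s e ≠ t e) {S : Set E} {u v : V}
    (h : (edgeGraph s t S).Reachable u v) :
    ∃ z : E → ℤ, (∀ e ∉ S, z e = 0) ∧
      ∀ w, inflow s t z w = (if v = w then 1 else 0) - (if u = w then 1 else 0) := by
  classical
  obtain ⟨p⟩ := h
  induction p with
  | nil => exact ⟨0, by simp, by simp [inflow]⟩
  | @cons u v x h p ih =>
    obtain ⟨z, hz, hin⟩ := ih
    obtain ⟨e, heS, ⟨rfl, rfl⟩ | ⟨rfl, rfl⟩⟩ := (edgeGraph_adj hne).1 h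
    · refine ⟨z + Pi.single e 1, fun e' he' => ?_, fun w => ?_⟩
      · have : e' ≠ e := fun h => he' (h ▸ heS)
        simp [hz e' he', this]
      · rw [inflow_add, hin, inflow_single]; ring
    · refine ⟨z + -Pi.single e 1, fun e' he' => ?_, fun w => ?_⟩
      · have : e' ≠ e := fun h => he' (h ▸ heS)
        simp [hz e' he', this]
      · rw [inflow_add, hin, inflow_neg, inflow_single]; ring

variable [Fintype V] [Fintype F] [DecidableEq F] {M : Matrix F E ℤ}

open Matrix

/-- Fundamental cycles: if the edges outside the range of `f` connect the graph, the columns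
`f` of the cycle matrix have a left inverse. -/
theorem exists_mul_submatrix_eq_one (hne : ∀ e, s e ≠ t e)
    (hspan : ∀ z, (∀ v, inflow s t z v = 0) → ∃ c, z = c ᵥ* M)
    {I : Type*} [DecidableEq I] {f : I → E} (hf : Function.Injective f)
    (hconn : (edgeGraph s t (Set.range f)ᶜ).Connected) :
    ∃ C : Matrix I F ℤ, C * M.submatrix id f = 1 := by
  classical
  -- The edge `f i` is closed up to a cycle by a unit flow from its head back to its tail that
  -- avoids every `f j`. On the edges `f j` this cycle is the indicator of `i`, and it is a
  -- combination of rows of `M`.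
  have key : ∀ i, ∃ c : F → ℤ, ∀ j, (c ᵥ* M) (f j) = if i = j then 1 else 0 := by
    intro i
    obtain ⟨z, hz, hin⟩ := exists_unit_flow hne (hconn.preconnected (t (f i)) (s (f i)))
    obtain ⟨c, hc⟩ := hspan (z + Pi.single (f i) 1) fun v => by
      rw [inflow_add, hin, inflow_single]; ring
    refine ⟨c, fun j => ?_⟩
    rw [← hc]
    have : z (f j) = 0 := hz _ (by simp)
    simp [this, Pi.single_apply, hf.eq_iff, eq_comm]
  choose C hC using key
  refine ⟨C, ?_⟩
  ext i j
  rw [Matrix.one_apply, ← hC i j]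
  rfl

/-- The left inverse makes the chosen columns an injection ℤ^I → ℤ^F; compare ranks. -/
theorem card_le_of_connected (hne : ∀ e, s e ≠ t e)
    (hspan : ∀ z, (∀ v, inflow s t z v = 0) → ∃ c, z = c ᵥ* M)
    {I : Type*} [Fintype I] [DecidableEq I] {f : I → E} (hf : Function.Injective f)
    (hconn : (edgeGraph s t (Set.range f)ᶜ).Connected) : Fintype.card I ≤ Fintype.card F := by
  obtain ⟨C, hC⟩ := exists_mul_submatrix_eq_one hne hspan hf hconn
  have hinj : Function.Injective (Matrix.mulVecLin (M.submatrix id f)) := by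
    refine Function.LeftInverse.injective (g := Matrix.mulVecLin C) fun x => ?_
    simp [Matrix.mulVec_mulVec, hC]
  simpa using LinearMap.finrank_le_finrank_of_injective hinj

theorem eq_of_connected (hne : ∀ e, s e ≠ t e) {S : Set E}
    (hconn : (edgeGraph s t S).Preconnected) {φ : V → ℤ}
    (hφ : ∀ e ∈ S, φ (s e) = φ (t e)) (u v : V) : φ u = φ v := by
  obtain ⟨p⟩ := hconn u v
  induction p with
  | nil => rfl
  | cons h p ih =>
    rw [← ih]
    obtain ⟨e, heS, ⟨rfl, rfl⟩ | ⟨rfl, rfl⟩⟩ := (edgeGraph_adj hne).1 h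
    · exact hφ e heS
    · exact (hφ e heS).symm

/-- Flows and differences of potentials are orthogonal in ℤ^E, so their ranks add up to at most |E|.
Recording also the value of the potential at `v₀` removes the constants from the kernel, which
explains the extra 1. -/
theorem card_add_card_le (hne : ∀ e, s e ≠ t e) (hM : ∀ f v, inflow s t (M f) v = 0)
    (hind : ∀ c, c ᵥ* M = 0 → c = 0)
    (hconn : (edgeGraph s t Set.univ).Connected) :
    Fintype.card F + Fintype.card V ≤ Fintype.card E + 1 := by
  obtain ⟨v₀⟩ := hconn.nonempty
  let D : Matrix E V ℤ := fun e v => (if t e = v then 1 else 0) - (if s e = v then 1 else 0)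
  have hD : ∀ φ e, (D *ᵥ φ) e = φ (t e) - φ (s e) := by
    intro φ e
    simp [D, Matrix.mulVec, dotProduct, sub_mul]
  let L : ((F → ℤ) × (V → ℤ)) →ₗ[ℤ] (E → ℤ) × ℤ :=
    (M.vecMulLinear.coprod D.mulVecLin).prod (LinearMap.proj v₀ ∘ₗ LinearMap.snd ℤ _ _)
  have hL : Function.Injective L := by
    rw [← LinearMap.ker_eq_bot, LinearMap.ker_eq_bot']
    rintro ⟨c, φ⟩ h
    have h1 : c ᵥ* M + D *ᵥ φ = 0 := congrArg Prod.fst h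
    have h2 : φ v₀ = 0 := congrArg Prod.snd h
    have hflow : ∀ v, inflow s t (c ᵥ* M) v = 0 := by
      intro v
      have : inflow s t (c ᵥ* M) v = ∑ f, c f * inflow s t (M f) v := by
        simp only [inflow, Matrix.vecMul, dotProduct, Finset.sum_mul, Finset.mul_sum]
        rw [Finset.sum_comm]
        simp only [mul_assoc]
      rw [this]
      simp [hM]
    have h3 : (c ᵥ* M) ⬝ᵥ (c ᵥ* M) = 0 := by
      have := sum_flow_mul_diff hflow φ
      have h4 : (c ᵥ* M) ⬝ᵥ (D *ᵥ φ) = 0 := by simpa [dotProduct, hD] using this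
      have h5 := congrArg (fun x => (c ᵥ* M) ⬝ᵥ x) h1
      simpa [dotProduct_add, h4] using h5
    have h6 : c ᵥ* M = 0 := dotProduct_self_eq_zero.1 h3
    have h7 : D *ᵥ φ = 0 := by simpa [h6] using h1
    have h8 : φ = 0 := by
      funext v
      rw [eq_of_connected hne hconn.preconnected (φ := φ) (fun e _ => ?_) v v₀, h2]; rfl
      have := congrFun h7 e
      rw [hD] at this
      simp only [Pi.zero_apply] at this
      omega
    rw [hind c h6, h8]
    rfl
  simpa using LinearMap.finrank_le_finrank_of_injective hL

theorem natCard_edgeSet (hinj : Function.Injective fun e => s(s e, t e))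
    (hne : ∀ e, s e ≠ t e) (S : Set E) : Nat.card (edgeGraph s t S).edgeSet = S.ncard := by
  rw [edgeSet_edgeGraph hne, Nat.card_coe_set_eq, Set.ncard_image_of_injective _ hinj]

/-- Euler's formula for a connected graph with a basis of its cycle lattice. -/
theorem card_add_card_eq (hinj : Function.Injective fun e => s(s e, t e))
    (hne : ∀ e, s e ≠ t e) (hM : ∀ f v, inflow s t (M f) v = 0)
    (hind : ∀ c, c ᵥ* M = 0 → c = 0)
    (hspan : ∀ z, (∀ v, inflow s t z v = 0) → ∃ c, z = c ᵥ* M)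
    (hconn : (edgeGraph s t Set.univ).Connected) :
    Fintype.card F + Fintype.card V = Fintype.card E + 1 := by
  classical
  refine le_antisymm (card_add_card_le hne hM hind hconn) ?_
  -- The complement of a spanning tree has |E| − |V| + 1 edges, and at most |F| by the rank bound.
  obtain ⟨T, hT, htree⟩ := hconn.exists_isTree_le
  obtain ⟨S, rfl⟩ := exists_eq_edgeGraph hne hT
  have h1 := (SimpleGraph.isTree_iff_connected_and_card.1 htree).2
  rw [natCard_edgeSet hinj hne, Nat.card_eq_fintype_card] at h1
  have h2 := card_le_of_connected hne hspan (I := (Sᶜ : Set E)) (f := Subtype.val)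
    Subtype.val_injective (by rw [Subtype.range_coe, compl_compl]; exact htree.connected)
  rw [← Nat.card_eq_fintype_card, Nat.card_coe_set_eq] at h2
  have h3 := Set.ncard_add_ncard_compl S
  rw [Nat.card_eq_fintype_card] at h3
  omega

/-- By Euler's formula the complement of |F| edges has |V| − 1 edges, so it is a tree as soon as it
is connected. In that case the minor has an integral left inverse and is ±1; otherwise a
disconnection yields a kernel vector. -/
theorem det_submatrix_sq (hinj : Function.Injective fun e => s(s e, t e))
    (hne : ∀ e, s e ≠ t e) (hM : ∀ f v, inflow s t (M f) v = 0)
    (hind : ∀ c, c ᵥ* M = 0 → c = 0)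
    (hspan : ∀ z, (∀ v, inflow s t z v = 0) → ∃ c, z = c ᵥ* M)
    (hconn : (edgeGraph s t Set.univ).Connected) {f : F → E} (hf : Function.Injective f)
    [Decidable (edgeGraph s t (Set.range f)ᶜ).IsTree] :
    (M.submatrix id f).det * (M.submatrix id f).det =
      if (edgeGraph s t (Set.range f)ᶜ).IsTree then 1 else 0 := by
  classical
  have hcard := card_add_card_eq hinj hne hM hind hspan hconn
  have hiff : (edgeGraph s t (Set.range f)ᶜ).IsTree ↔
      (edgeGraph s t (Set.range f)ᶜ).Connected := by
    rw [SimpleGraph.isTree_iff_connected_and_card, and_iff_left]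
    rw [natCard_edgeSet hinj hne, Nat.card_eq_fintype_card]
    have h3 := Set.ncard_add_ncard_compl (Set.range f)
    rw [Nat.card_eq_fintype_card, Set.ncard_range_of_injective hf,
      Nat.card_eq_fintype_card] at h3
    omega
  split_ifs with h
  · obtain ⟨C, hC⟩ := exists_mul_submatrix_eq_one hne hspan hf (hiff.1 h)
    have hdet := congrArg Matrix.det hC
    rw [Matrix.det_mul, Matrix.det_one] at hdet
    exact Int.isUnit_mul_self (IsUnit.of_mul_eq_one_right _ hdet)
  · rw [hiff, SimpleGraph.connected_iff] at h
    have hne' := hconn.nonempty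
    have : ¬ (edgeGraph s t (Set.range f)ᶜ).Preconnected := fun h' => h ⟨h', hne'⟩
    simp only [SimpleGraph.Preconnected, not_forall] at this
    obtain ⟨u, v, huv⟩ := this
    -- Indicator of one component of the complement. Its differences vanish off the range of `f`,
    -- are orthogonal to every row, and are not all zero because the whole graph is connected.
    let φ : V → ℤ := fun w => if (edgeGraph s t (Set.range f)ᶜ).Reachable u w then 1 else 0
    have hφ : ∀ e ∉ Set.range f, φ (s e) = φ (t e) := by
      intro e he
      have hadj := edgeGraph_adj_of_mem hne (S := (Set.range f)ᶜ) he
      simp only [φ]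
      congr 1
      exact propext ⟨fun h => h.trans hadj.reachable, fun h => h.trans hadj.symm.reachable⟩
    have hdet : (M.submatrix id f).det = 0 := by
      rw [← Matrix.exists_mulVec_eq_zero_iff]
      refine ⟨fun i => φ (t (f i)) - φ (s (f i)), ?_, ?_⟩
      · intro h0
        have := eq_of_connected hne hconn.preconnected (φ := φ) (fun e _ => ?_) u v
        · simp [φ, huv] at this
        · by_cases he : e ∈ Set.range f
          · obtain ⟨i, rfl⟩ := he
            have := congrFun h0 i
            simp only [Pi.zero_apply] at this
            omega
          · exact hφ e he
      · funext i
        have h1 := sum_flow_mul_diff (hM i) φ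
        simp only [Matrix.mulVec, dotProduct, Matrix.submatrix_apply, id_eq, Pi.zero_apply]
        rw [← h1]
        refine Fintype.sum_of_injective f hf _ _ (fun e he => ?_) fun j => rfl
        rw [hφ e he, sub_self, mul_zero]
    simp [hdet]

/-- The multiplicity with which one set of edges occurs in the Cauchy–Binet sum over maps; it
cancels the factorial there. -/
theorem card_injective_range_eq [DecidableEq E] {S : Finset E}
    (hS : S.card = Fintype.card F) :
    (Finset.univ.filter fun f : F → E =>
      Function.Injective f ∧ Finset.univ.image f = S).card = (Fintype.card F).factorial := by
  classical
  have e : F ≃ S := Fintype.equivOfCardEq (by simp [hS])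
  rw [← Fintype.card_equiv e]
  symm
  refine Finset.card_bij (fun g _ i => (g i : E)) ?_ ?_ ?_ (s := Finset.univ)
  · intro g _
    simp only [Finset.mem_filter, Finset.mem_univ, true_and]
    refine ⟨Subtype.val_injective.comp g.injective, ?_⟩
    ext x
    simp only [Finset.mem_image, Finset.mem_univ, true_and]
    constructor
    · rintro ⟨i, rfl⟩; exact (g i).2
    · intro hx; exact ⟨g.symm ⟨x, hx⟩, by simp⟩
  · intro g _ g' _ h
    ext i
    exact congrFun h i
  · intro f hf
    simp only [Finset.mem_filter, Finset.mem_univ, true_and] at hf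
    obtain ⟨hinj, himg⟩ := hf
    have hmem : ∀ i, f i ∈ S := fun i => himg ▸ Finset.mem_image_of_mem f (Finset.mem_univ i)
    refine ⟨Equiv.ofBijective (fun i => ⟨f i, hmem i⟩) ⟨fun i j h => ?_, ?_⟩, Finset.mem_univ _, ?_⟩
    · exact hinj (congrArg Subtype.val h)
    · rintro ⟨x, hx⟩
      rw [← himg] at hx
      obtain ⟨i, -, rfl⟩ := Finset.mem_image.1 hx
      exact ⟨i, rfl⟩
    · rfl

/-- The matrix-tree theorem for a basis of the cycle lattice. -/
theorem ncard_spanningTrees_eq_det (hinj : Function.Injective fun e => s(s e, t e))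
    (hne : ∀ e, s e ≠ t e) (hM : ∀ f v, inflow s t (M f) v = 0)
    (hind : ∀ c, c ᵥ* M = 0 → c = 0)
    (hspan : ∀ z, (∀ v, inflow s t z v = 0) → ∃ c, z = c ᵥ* M)
    (hconn : (edgeGraph s t Set.univ).Connected) :
    (({T : SimpleGraph V | T ≤ edgeGraph s t Set.univ ∧ T.IsTree}.ncard : ℕ) : ℤ) =
      (M * Mᵀ).det := by
  classical
  -- Spanning trees are indexed by their complements, which are the column sets of the maximal
  -- minors.
  set 𝒯 : Finset (Finset E) :=
    Finset.univ.filter fun S => (edgeGraph s t (S : Set E)ᶜ).IsTree with h𝒯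
  have hcard := card_add_card_eq hinj hne hM hind hspan hconn
  have hcardT : ∀ S ∈ 𝒯, S.card = Fintype.card F := by
    intro S hS
    have htree := (Finset.mem_filter.1 hS).2
    have h1 := (SimpleGraph.isTree_iff_connected_and_card.1 htree).2
    rw [natCard_edgeSet hinj hne, Nat.card_eq_fintype_card] at h1
    have h3 := Set.ncard_add_ncard_compl (S : Set E)
    rw [Nat.card_eq_fintype_card, Set.ncard_coe_finset] at h3
    omega
  have hset : {T : SimpleGraph V | T ≤ edgeGraph s t Set.univ ∧ T.IsTree} =
      (fun S : Finset E => edgeGraph s t (S : Set E)ᶜ) '' 𝒯 := by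
    ext T
    simp only [Set.mem_ofPred_eq, Set.mem_image, Finset.mem_coe, h𝒯, Finset.mem_filter,
      Finset.mem_univ, true_and]
    constructor
    · rintro ⟨hle, hT⟩
      obtain ⟨S, rfl⟩ := exists_eq_edgeGraph hne hle
      exact ⟨Sᶜ.toFinset, by simpa using hT, by simp⟩
    · rintro ⟨S, hS, rfl⟩
      refine ⟨SimpleGraph.fromEdgeSet_mono (Set.image_mono (Set.subset_univ _)), hS⟩
  have hN : {T : SimpleGraph V | T ≤ edgeGraph s t Set.univ ∧ T.IsTree}.ncard = 𝒯.card := by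
    rw [hset, Set.ncard_image_of_injective, Set.ncard_coe_finset]
    intro S S' h
    have := edgeGraph_injective hinj hne h
    exact Finset.coe_injective (compl_injective this)
  have hsum := Matrix.factorial_mul_det_mul M Mᵀ
  have hterm : ∀ f : F → E, (M.submatrix id f).det * (Mᵀ.submatrix f id).det =
      if Function.Injective f ∧ Finset.univ.image f ∈ 𝒯 then 1 else 0 := by
    intro f
    rw [← Matrix.transpose_submatrix, Matrix.det_transpose]
    by_cases hf : Function.Injective f
    · rw [det_submatrix_sq hinj hne hM hind hspan hconn hf]
      simp [hf, h𝒯]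
    · rw [if_neg (fun h => hf h.1)]
      simp only [Function.Injective, not_forall] at hf
      obtain ⟨i, j, hij, hne'⟩ := hf
      rw [Matrix.det_zero_of_column_eq hne' (fun k => by simp [hij]), zero_mul]
  rw [Finset.sum_congr rfl fun f _ => hterm f, Finset.sum_boole] at hsum
  have hcount : (Finset.univ.filter fun f : F → E =>
      Function.Injective f ∧ Finset.univ.image f ∈ 𝒯).card =
        𝒯.card * (Fintype.card F).factorial := by
    rw [Finset.card_eq_sum_card_fiberwise (f := fun f => Finset.univ.image f) (t := 𝒯)
      (fun f hf => (Finset.mem_filter.1 hf).2.2)]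
    rw [← smul_eq_mul, ← Finset.sum_const]
    refine Finset.sum_congr rfl fun S hS => ?_
    rw [← card_injective_range_eq (hcardT S hS)]
    congr 1
    ext f
    simp only [Finset.mem_filter, Finset.mem_univ, true_and]
    constructor
    · rintro ⟨⟨h1, -⟩, h2⟩; exact ⟨h1, h2⟩
    · rintro ⟨h1, h2⟩; exact ⟨⟨h1, h2 ▸ hS⟩, h2⟩
  rw [hcount] at hsum
  have hpos : ((Fintype.card F).factorial : ℤ) ≠ 0 := by
    exact_mod_cast (Nat.factorial_pos _).ne'
  rw [hN]
  refine mul_left_cancel₀ hpos ?_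
  rw [hsum]
  push_cast
  ring

end EdgeParam

/-! ### Topology of the loop region: potentials, boundedness, connectedness -/

namespace GridGraph

open Set

theorem squareLattice_adj_iff (p q : ℤ × ℤ) : squareLattice.Adj p q ↔
    q = (p.1 + 1, p.2) ∨ p = (q.1 + 1, q.2) ∨ q = (p.1, p.2 + 1) ∨ p = (q.1, q.2 + 1) := by
  obtain ⟨a, b⟩ := p
  obtain ⟨c, d⟩ := q
  simp only [squareLattice, Prod.mk.injEq]
  rcases abs_cases (a - c) with ⟨h1, h1'⟩ | ⟨h1, h1'⟩ <;>
    rcases abs_cases (b - d) with ⟨h2, h2'⟩ | ⟨h2, h2'⟩ <;> rw [h1, h2] <;> omega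

theorem squareLattice_adj_right (a b : ℤ) : squareLattice.Adj (a, b) (a + 1, b) :=
  (squareLattice_adj_iff _ _).2 (Or.inl rfl)

theorem squareLattice_adj_up (a b : ℤ) : squareLattice.Adj (a, b) (a, b + 1) :=
  (squareLattice_adj_iff _ _).2 (Or.inr (Or.inr (Or.inl rfl)))

theorem mem_segment_right {a b : ℤ} {y : ℝ × ℝ} :
    y ∈ segment ℝ (latticePoint (a, b)) (latticePoint (a + 1, b)) ↔
      y.2 = b ∧ (a : ℝ) ≤ y.1 ∧ y.1 ≤ a + 1 := by
  rw [segment_eq_image]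
  simp only [latticePoint, mem_image, mem_Icc]
  constructor
  · rintro ⟨θ, ⟨h0, h1⟩, rfl⟩
    simp only [Prod.fst_add, Prod.snd_add, Prod.smul_fst, Prod.smul_snd, smul_eq_mul]
    push_cast
    refine ⟨by ring, by linarith, by linarith⟩
  · rintro ⟨h, h0, h1⟩
    refine ⟨y.1 - a, ⟨by linarith, by linarith⟩, ?_⟩
    ext
    · simp; ring
    · simp [h]; ring

theorem mem_segment_up {a b : ℤ} {y : ℝ × ℝ} :
    y ∈ segment ℝ (latticePoint (a, b)) (latticePoint (a, b + 1)) ↔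
      y.1 = a ∧ (b : ℝ) ≤ y.2 ∧ y.2 ≤ b + 1 := by
  rw [segment_eq_image]
  simp only [latticePoint, mem_image, mem_Icc]
  constructor
  · rintro ⟨θ, ⟨h0, h1⟩, rfl⟩
    simp only [Prod.fst_add, Prod.snd_add, Prod.smul_fst, Prod.smul_snd, smul_eq_mul]
    push_cast
    refine ⟨by ring, by linarith, by linarith⟩
  · rintro ⟨h, h0, h1⟩
    refine ⟨y.2 - b, ⟨by linarith, by linarith⟩, ?_⟩
    ext
    · simp [h]; ring
    · simp; ring

theorem eq_of_forall_eq_pred {f : ℤ → ℤ} (hf : ∀ y, f y = f (y - 1)) (a b : ℤ) :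
    f a = f b := by
  have h0 : ∀ a, f a = f 0 := fun a => by
    induction a using Int.induction_on with
    | zero => rfl
    | succ i ih => rw [hf, add_sub_cancel_right, ih]
    | pred i ih => rw [← hf, ih]
  rw [h0 a, h0 b]

/-- A flow on the lattice that vanishes outside a box is the boundary of a face function. -/
theorem exists_potential {N : ℤ} {h v : ℤ → ℤ → ℤ}
    (hh : ∀ x y, h x y ≠ 0 → |x| ≤ N ∧ |y| ≤ N) (hv : ∀ x y, v x y ≠ 0 → |x| ≤ N ∧ |y| ≤ N)
    (hdiv : ∀ x y, h (x - 1) y - h x y + v x (y - 1) - v x y = 0) :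
    ∃ c : ℤ → ℤ → ℤ, (∀ x y, h x y = c x y - c x (y - 1)) ∧
      (∀ x y, v x y = c (x - 1) y - c x y) ∧
      ∀ x y, c x y ≠ 0 → |x| ≤ N ∧ |y| ≤ N := by
  have hh0 : ∀ x y, N < |x| ∨ N < |y| → h x y = 0 := by
    intro x y hxy
    by_contra h0
    have := hh x y h0
    omega
  have hv0 : ∀ x y, N < |x| ∨ N < |y| → v x y = 0 := by
    intro x y hxy
    by_contra h0
    have := hv x y h0
    omega
  have hN : N < |-N - 1| := by rw [lt_abs]; right; omega
  -- Sum the horizontal flow up each column from the bottom of the box; the relation for `h`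
  -- telescopes.
  set c : ℤ → ℤ → ℤ := fun x y => ∑ j ∈ Finset.Icc (-N) y, h x j with hc
  have h1 : ∀ x y, h x y = c x y - c x (y - 1) := by
    intro x y
    by_cases hy : -N ≤ y
    · have : Finset.Icc (-N) y = insert y (Finset.Icc (-N) (y - 1)) := by
        ext j; simp only [Finset.mem_Icc, Finset.mem_insert]; omega
      simp only [hc]
      rw [this, Finset.sum_insert (by simp)]
      ring
    · simp only [hc]
      rw [Finset.Icc_eq_empty (by omega), Finset.Icc_eq_empty (by omega)]
      rw [hh0 x y (Or.inr (by rw [lt_abs]; omega))]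
      simp
  have hcx : ∀ x y, N < |x| → c x y = 0 := fun x y hx =>
    Finset.sum_eq_zero fun j _ => hh0 x j (Or.inl hx)
  have hcy : ∀ x y, y < -N → c x y = 0 := by
    intro x y hy
    simp only [hc]
    rw [Finset.Icc_eq_empty (by omega)]
    simp
  have h2 : ∀ x y, v x y = c (x - 1) y - c x y := by
    intro x y
    -- By zero divergence the defect of the second relation does not depend on `y`, and it vanishes
    -- below the box.
    have := eq_of_forall_eq_pred (f := fun y => v x y - (c (x - 1) y - c x y)) (fun y => by
      have e1 := hdiv x y
      have e2 := h1 x y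
      have e3 := h1 (x - 1) y
      linarith) y (-N - 1)
    rw [hcy _ (-N - 1) (by omega), hcy _ (-N - 1) (by omega), hv0 _ _ (Or.inr hN)] at this
    linarith
  refine ⟨c, h1, h2, fun x y hxy => ?_⟩
  refine ⟨not_lt.1 fun hx => hxy (hcx x y hx), ?_⟩
  rw [abs_le]
  refine ⟨not_lt.1 fun hy => hxy (hcy x y hy), not_lt.1 fun hy => hxy ?_⟩
  -- Above the box the vertical flow is zero, so `c` is constant along the row and equals its value
  -- far to the left, which is zero.
  have hrow : ∀ x, c x y = c (x - 1) y := fun x => by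
    have := h2 x y
    rw [hv0 x y (Or.inr (by rw [lt_abs]; omega))] at this
    linarith
  rw [eq_of_forall_eq_pred (f := fun x => c x y) hrow x (-N - 1)]
  exact hcx _ _ hN

variable {v₀ : ℤ × ℤ} {α : squareLattice.Walk v₀ v₀}

theorem notMem_loopRegion {x : ℝ × ℝ} : x ∉ loopRegion α ↔
    x ∉ loopTrace α ∧ ¬ Bornology.IsBounded (connectedComponentIn (loopTrace α)ᶜ x) := by
  simp only [loopRegion, loopInterior, mem_union, mem_ofPred_eq]
  tauto

theorem connectedComponentIn_subset_compl_loopRegion {x : ℝ × ℝ} (hx : x ∉ loopRegion α) :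
    connectedComponentIn (loopTrace α)ᶜ x ⊆ (loopRegion α)ᶜ := by
  rw [notMem_loopRegion] at hx
  intro y hy
  have h1 : y ∉ loopTrace α := connectedComponentIn_subset _ _ hy
  refine notMem_loopRegion.2 ⟨h1, ?_⟩
  rw [← connectedComponentIn_eq hy]
  exact hx.2

theorem mem_loopRegion_of_isPreconnected {x y : ℝ × ℝ} {S : Set (ℝ × ℝ)} (hS : IsPreconnected S)
    (hdisj : S ⊆ (loopTrace α)ᶜ) (hxS : x ∈ S) (hyS : y ∈ S) (hx : x ∈ loopRegion α) :
    y ∈ loopRegion α := by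
  by_contra hy
  exact connectedComponentIn_subset_compl_loopRegion hy
    (hS.subset_connectedComponentIn hyS hdisj hxS) hx

/-- Points from which a ray escapes without meeting the loop are outside. -/
theorem notMem_loopRegion_of_ray {x d : ℝ × ℝ} (hd : d ≠ 0)
    (hray : ∀ t : ℝ, 0 ≤ t → x + t • d ∉ loopTrace α) : x ∉ loopRegion α := by
  refine notMem_loopRegion.2 ⟨by simpa using hray 0 le_rfl, fun hb => ?_⟩
  have hpre : IsPreconnected ((fun t : ℝ => x + t • d) '' Ici 0) :=
    isPreconnected_Ici.image _ (by fun_prop)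
  have hsub : (fun t : ℝ => x + t • d) '' Ici 0 ⊆ connectedComponentIn (loopTrace α)ᶜ x := by
    refine hpre.subset_connectedComponentIn ⟨0, by simp, by simp⟩ ?_
    rintro _ ⟨t, ht, rfl⟩
    exact hray t ht
  obtain ⟨C, hC⟩ := (hb.subset hsub).exists_norm_le
  have hdn : 0 < ‖d‖ := norm_pos_iff.2 hd
  -- Far enough along the ray that ‖x + t • d‖ exceeds the supposed bound `C`.
  set t := (|C| + ‖x‖ + 1) / ‖d‖ with ht
  have ht0 : 0 ≤ t := by positivity
  have h1 := hC _ ⟨t, ht0, rfl⟩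
  have h2 : ‖t • d‖ = |C| + ‖x‖ + 1 := by
    rw [norm_smul, Real.norm_of_nonneg ht0, ht, div_mul_cancel₀ _ hdn.ne']
  have h3 : ‖t • d‖ ≤ ‖x + t • d‖ + ‖x‖ := by
    have := norm_sub_le (x + t • d) x
    simpa using this
  simp only at h1
  linarith [le_abs_self C]

theorem exists_box (α : squareLattice.Walk v₀ v₀) :
    ∃ N : ℤ, ∀ x ∈ loopTrace α, |x.1| ≤ N ∧ |x.2| ≤ N := by
  have hfin : (α.support.toFinset : Set (ℤ × ℤ)).Finite := Finset.finite_toSet _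
  obtain ⟨N, hN⟩ : ∃ N : ℤ, ∀ p ∈ α.support, |p.1| ≤ N ∧ |p.2| ≤ N := by
    obtain ⟨N, hN⟩ := (hfin.image fun p : ℤ × ℤ => max |p.1| |p.2|).bddAbove
    refine ⟨N, fun p hp => ?_⟩
    have := hN ⟨p, by simpa using hp, rfl⟩
    simpa using this
  refine ⟨N, ?_⟩
  rintro x ⟨p, q, hpq, hx⟩
  have hp := hN p (α.fst_mem_support_of_mem_edges hpq)
  have hq := hN q (α.snd_mem_support_of_mem_edges hpq)
  have hconv : Convex ℝ (Icc (-(N : ℝ)) N ×ˢ Icc (-(N : ℝ)) N) :=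
    (convex_Icc _ _).prod (convex_Icc _ _)
  have hmem : ∀ r : ℤ × ℤ, |r.1| ≤ N ∧ |r.2| ≤ N →
      latticePoint r ∈ Icc (-(N : ℝ)) N ×ˢ Icc (-(N : ℝ)) N := by
    intro r hr
    simp only [latticePoint, mem_prod, mem_Icc, ← abs_le]
    exact_mod_cast hr
  have := hconv.segment_subset (hmem p hp) (hmem q hq) hx
  simpa only [mem_prod, mem_Icc, ← abs_le] using this

/-- A point beyond the box escapes along an axis-parallel ray pointing away from it. -/
theorem loopRegion_subset_box {N : ℤ} (hN : ∀ x ∈ loopTrace α, |x.1| ≤ N ∧ |x.2| ≤ N)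
    {x : ℝ × ℝ} (hx : x ∈ loopRegion α) : |x.1| ≤ N ∧ |x.2| ≤ N := by
  by_contra hcon
  have key : ∀ d : ℝ × ℝ, d ≠ 0 → (∀ t : ℝ, 0 ≤ t → (N : ℝ) < |x.1 + t * d.1| ∨
      (N : ℝ) < |x.2 + t * d.2|) → False := by
    intro d hd h
    refine notMem_loopRegion_of_ray hd (fun t ht hmem => ?_) hx
    have := hN _ hmem
    simp only [Prod.fst_add, Prod.snd_add, Prod.smul_fst, Prod.smul_snd, smul_eq_mul] at this
    rcases h t ht with h | h
    · linarith [this.1]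
    · linarith [this.2]
  rw [not_and_or, not_le, not_le, lt_abs, lt_abs] at hcon
  rcases hcon with (h | h) | (h | h)
  · exact key (1, 0) (by simp) fun t ht => Or.inl (lt_abs.2 (Or.inl (by simp only; linarith)))
  · exact key (-1, 0) (by simp) fun t ht => Or.inl (lt_abs.2 (Or.inr (by simp only; linarith)))
  · exact key (0, 1) (by simp) fun t ht => Or.inr (lt_abs.2 (Or.inl (by simp only; linarith)))
  · exact key (0, -1) (by simp) fun t ht => Or.inr (lt_abs.2 (Or.inr (by simp only; linarith)))

theorem mem_loopTrace_cases {x : ℝ × ℝ} (hx : x ∈ loopTrace α) : ∃ a b : ℤ,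
    (s((a, b), (a + 1, b)) ∈ α.edges ∧ x.2 = b ∧ (a : ℝ) ≤ x.1 ∧ x.1 ≤ a + 1) ∨
    (s((a, b), (a, b + 1)) ∈ α.edges ∧ x.1 = a ∧ (b : ℝ) ≤ x.2 ∧ x.2 ≤ b + 1) := by
  obtain ⟨p, q, hpq, hx⟩ := hx
  have hadj := α.adj_of_mem_edges hpq
  obtain ⟨a, b⟩ := p
  obtain ⟨c, d⟩ := q
  rw [squareLattice_adj_iff] at hadj
  simp only [Prod.mk.injEq] at hadj
  rcases hadj with ⟨rfl, rfl⟩ | ⟨rfl, rfl⟩ | ⟨rfl, rfl⟩ | ⟨rfl, rfl⟩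
  · exact ⟨a, d, Or.inl ⟨hpq, mem_segment_right.1 hx⟩⟩
  · rw [segment_symm] at hx
    rw [Sym2.eq_swap] at hpq
    exact ⟨c, b, Or.inl ⟨hpq, mem_segment_right.1 hx⟩⟩
  · exact ⟨c, b, Or.inr ⟨hpq, mem_segment_up.1 hx⟩⟩
  · rw [segment_symm] at hx
    rw [Sym2.eq_swap] at hpq
    exact ⟨a, d, Or.inr ⟨hpq, mem_segment_up.1 hx⟩⟩

theorem latticePoint_mem_loopTrace_of_edge {p q : ℤ × ℤ} (h : s(p, q) ∈ α.edges) :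
    latticePoint p ∈ loopTrace α ∧ latticePoint q ∈ loopTrace α :=
  ⟨⟨p, q, h, left_mem_segment ℝ _ _⟩, ⟨p, q, h, right_mem_segment ℝ _ _⟩⟩

theorem mem_support_of_mem_loopTrace {p : ℤ × ℤ} (hp : latticePoint p ∈ loopTrace α) :
    p ∈ α.support := by
  obtain ⟨x, y⟩ := p
  obtain ⟨a, b, ⟨he, h1, h2, h3⟩ | ⟨he, h1, h2, h3⟩⟩ := mem_loopTrace_cases hp
  all_goals
    simp only [latticePoint] at h1 h2 h3
    have h1' := (Int.cast_injective (α := ℝ)) h1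
    subst h1'
    have h2' := (Int.cast_le (R := ℝ)).1 h2
    norm_cast at h3
  · rcases (show x = a ∨ x = a + 1 by omega) with rfl | rfl
    · exact α.fst_mem_support_of_mem_edges he
    · exact α.snd_mem_support_of_mem_edges he
  · rcases (show y = b ∨ y = b + 1 by omega) with rfl | rfl
    · exact α.fst_mem_support_of_mem_edges he
    · exact α.snd_mem_support_of_mem_edges he

/-- A horizontal lattice line meets the loop in lattice points and whole unit edges. This turns a
hit at a real point into a hit at a lattice point. -/
theorem floor_mem_loopTrace {x : ℝ × ℝ} {b : ℤ} (hx : x ∈ loopTrace α) (hb : x.2 = b) :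
    latticePoint (⌊x.1⌋, b) ∈ loopTrace α := by
  have hx' := hx
  obtain ⟨a, b', ⟨he, h1, h2, h3⟩ | ⟨he, h1, h2, h3⟩⟩ := mem_loopTrace_cases hx
  · have hbb : b = b' := by rw [hb] at h1; exact_mod_cast h1
    subst hbb
    rcases h3.lt_or_eq with h3 | h3
    · rw [Int.floor_eq_iff.2 ⟨h2, h3⟩]
      exact (latticePoint_mem_loopTrace_of_edge he).1
    · rw [show ⌊x.1⌋ = a + 1 by rw [h3]; exact_mod_cast Int.floor_intCast (a + 1)]
      exact (latticePoint_mem_loopTrace_of_edge he).2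
  · rw [h1, Int.floor_intCast]
    rw [show latticePoint (a, b) = x from Prod.ext h1.symm hb.symm]
    exact hx'

section Subgraph

variable {G : squareLattice.Subgraph}
  (hverts : ∀ p, p ∈ G.verts ↔ latticePoint p ∈ loopRegion α)
  (hadj : ∀ p q, G.Adj p q ↔
    squareLattice.Adj p q ∧ segment ℝ (latticePoint p) (latticePoint q) ⊆ loopRegion α)

include hadj in
theorem toSubgraph_le_of_loop (hnil : ¬ α.Nil) : α.toSubgraph ≤ G := by
  rw [SimpleGraph.Walk.toSubgraph_le_iff hnil]
  intro e
  induction e with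
  | _ p q =>
    intro h
    exact (hadj p q).2 ⟨α.adj_of_mem_edges h, fun x hx => Or.inl ⟨p, q, h, hx⟩⟩

include hverts hadj in
-- Walk to the right until the loop is met. An edge leaving a vertex off the loop cannot meet the
-- loop before its far end, so it stays in the region and belongs to `G`.
theorem reachable_of_trace (k : ℕ) : ∀ (p : ℤ × ℤ) (hp : p ∈ G.verts),
    latticePoint (p.1 + k, p.2) ∈ loopTrace α →
      ∃ (q : ℤ × ℤ) (hq : q ∈ G.verts), q ∈ α.support ∧ G.coe.Reachable ⟨p, hp⟩ ⟨q, hq⟩ := by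
  induction k with
  | zero =>
    intro p hp h
    exact ⟨p, hp, mem_support_of_mem_loopTrace (by simpa using h), SimpleGraph.Reachable.rfl⟩
  | succ k ih =>
    intro p hp h
    by_cases hpt : latticePoint p ∈ loopTrace α
    · exact ⟨p, hp, mem_support_of_mem_loopTrace hpt, SimpleGraph.Reachable.rfl⟩
    obtain ⟨a, b⟩ := p
    have hpR := (hverts _).1 hp
    have hedge : G.Adj (a, b) (a + 1, b) := by
      refine (hadj _ _).2 ⟨squareLattice_adj_right a b, fun y hy => ?_⟩
      by_cases hyt : y ∈ loopTrace α
      · exact Or.inl hyt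
      have hy' := mem_segment_right.1 hy
      -- The segment from `(a, b)` to `y` avoids the loop: a hit `w` before the far end would put
      -- `(a, b)` on the loop, and a hit at the far end would force `y = w`.
      refine mem_loopRegion_of_isPreconnected
        (convex_segment (𝕜 := ℝ) (latticePoint (a, b)) y).isPreconnected (fun w hw hwt => ?_)
        (left_mem_segment ℝ _ _) (right_mem_segment ℝ _ _) hpR
      have hconv := (convex_segment (𝕜 := ℝ) (latticePoint (a, b))
        (latticePoint (a + 1, b))).segment_subset (left_mem_segment ℝ _ _) hy hw
      have hw' := mem_segment_right.1 hconv
      rcases hw'.2.2.lt_or_eq with hlt | heq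
      · have := floor_mem_loopTrace hwt hw'.1
        rw [Int.floor_eq_iff.2 ⟨hw'.2.1, hlt⟩] at this
        exact hpt this
      · have hyw : w.1 ≤ y.1 := by
          rw [segment_eq_image] at hw
          obtain ⟨θ, ⟨hθ0, hθ1⟩, rfl⟩ := hw
          simp only [latticePoint, Prod.fst_add, Prod.smul_fst, smul_eq_mul]
          nlinarith [hy'.2.1]
        apply hyt
        have : y = w := Prod.ext (by linarith [hy'.2.2]) (by rw [hy'.1, hw'.1])
        rwa [this]
    have hp' : ((a + 1, b) : ℤ × ℤ) ∈ G.verts := hedge.snd_mem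
    obtain ⟨q, hq, hqs, hr⟩ := ih (a + 1, b) hp' (by
      have e : (a + 1 + (k : ℤ), b) = (a + ((k + 1 : ℕ) : ℤ), b) := by push_cast; congr 1; ring
      simpa only [e] using h)
    refine ⟨q, hq, hqs, SimpleGraph.Reachable.trans (SimpleGraph.Adj.reachable ?_) hr⟩
    exact hedge.coe

include hverts hadj in
-- The rightward ray from any vertex must hit the loop, since otherwise the vertex would be outside;
-- and the loop itself is connected.
theorem coe_connected_of_loop (hnil : ¬ α.Nil) : G.coe.Connected := by
  have hle := toSubgraph_le_of_loop hadj hnil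
  have hv₀ : v₀ ∈ G.verts := hle.1 (by simp)
  rw [SimpleGraph.connected_iff_exists_forall_reachable]
  refine ⟨⟨v₀, hv₀⟩, ?_⟩
  rintro ⟨p, hp⟩
  have hex : ∃ k : ℕ, latticePoint (p.1 + k, p.2) ∈ loopTrace α := by
    by_contra hno
    push Not at hno
    refine notMem_loopRegion_of_ray (d := (1, 0)) (by simp) (fun t ht hmem => ?_)
      ((hverts p).1 hp)
    have := floor_mem_loopTrace (b := p.2) hmem (by simp [latticePoint])
    apply hno ⌊t⌋₊
    convert this using 3
    simp only [latticePoint, Prod.fst_add, Prod.smul_fst, smul_eq_mul, mul_one]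
    rw [Int.floor_intCast_add, Int.natCast_floor_eq_floor ht]
  obtain ⟨k, hk⟩ := hex
  obtain ⟨q, hq, hqs, hr⟩ := reachable_of_trace hverts hadj k p hp hk
  refine SimpleGraph.Reachable.trans ?_ hr.symm
  have hq' : q ∈ α.toSubgraph.verts := by simpa using hqs
  have hv' : v₀ ∈ α.toSubgraph.verts := by simp
  have := α.toSubgraph_connected.coe.preconnected ⟨v₀, hv'⟩ ⟨q, hq'⟩
  exact this.map (SimpleGraph.Subgraph.inclusion hle)

include hadj in
/-- A finitely supported face function that is constant across the edges missing from `G` is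
supported on the faces of `G`. -/
theorem mem_gridFaces_of_ne_zero {c : ℤ → ℤ → ℤ} {N : ℤ}
    (hc_h : ∀ x y, ¬ G.Adj (x, y) (x + 1, y) → c x y = c x (y - 1))
    (hc_v : ∀ x y, ¬ G.Adj (x, y) (x, y + 1) → c (x - 1) y = c x y)
    (hfar : ∀ x y, c x y ≠ 0 → |x| ≤ N ∧ |y| ≤ N) {x y : ℤ} (hxy : c x y ≠ 0) :
    (x, y) ∈ gridFaces G := by
  -- If a point off the region lies on a side shared by two closed squares, that side is not an edge
  -- of `G`, so `c` agrees on the two squares. Hence every closed square containing the point has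
  -- the value of its floor square.
  have step1 : ∀ (w : ℝ × ℝ), w ∉ loopRegion α → ∀ a b : ℤ, (a : ℝ) ≤ w.1 → w.1 ≤ a + 1 →
      (b : ℝ) ≤ w.2 → w.2 ≤ b + 1 → c a b = c ⌊w.1⌋ b := by
    intro w hw a b h1 h2 h3 h4
    rcases h2.lt_or_eq with h2 | h2
    · rw [Int.floor_eq_iff.2 ⟨h1, h2⟩]
    · have hf : ⌊w.1⌋ = a + 1 := by rw [h2]; exact_mod_cast Int.floor_intCast (a + 1)
      rw [hf, ← hc_v (a + 1) b, add_sub_cancel_right]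
      intro hA
      refine hw (((hadj _ _).1 hA).2 (mem_segment_up.2 ⟨?_, h3, h4⟩))
      rw [h2]; push_cast; rfl
  have step2 : ∀ (w : ℝ × ℝ), w ∉ loopRegion α → ∀ a b : ℤ, (a : ℝ) ≤ w.1 → w.1 ≤ a + 1 →
      (b : ℝ) ≤ w.2 → w.2 ≤ b + 1 → c a b = c a ⌊w.2⌋ := by
    intro w hw a b h1 h2 h3 h4
    rcases h4.lt_or_eq with h4 | h4
    · rw [Int.floor_eq_iff.2 ⟨h3, h4⟩]
    · have hf : ⌊w.2⌋ = b + 1 := by rw [h4]; exact_mod_cast Int.floor_intCast (b + 1)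
      rw [hf, hc_h a (b + 1), add_sub_cancel_right]
      intro hA
      refine hw (((hadj _ _).1 hA).2 (mem_segment_right.2 ⟨?_, h1, h2⟩))
      rw [h4]; push_cast; rfl
  have step : ∀ (w : ℝ × ℝ), w ∉ loopRegion α → ∀ a b : ℤ, (a : ℝ) ≤ w.1 → w.1 ≤ a + 1 →
      (b : ℝ) ≤ w.2 → w.2 ≤ b + 1 → c a b = c ⌊w.1⌋ ⌊w.2⌋ := by
    intro w hw a b h1 h2 h3 h4
    rw [step1 w hw a b h1 h2 h3 h4]
    exact step2 w hw _ b (Int.floor_le _) (Int.lt_floor_add_one _).le h3 h4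
  -- The value of `c` at the floor square is locally constant on the component of `w`. This
  -- component is unbounded while `c` has bounded support.
  have zero : ∀ w : ℝ × ℝ, w ∉ loopRegion α → c ⌊w.1⌋ ⌊w.2⌋ = 0 := by
    intro w hw
    set C := connectedComponentIn (loopTrace α)ᶜ w with hC
    have hCR : C ⊆ (loopRegion α)ᶜ := connectedComponentIn_subset_compl_loopRegion hw
    have hwC : w ∈ C := mem_connectedComponentIn (notMem_loopRegion.1 hw).1
    have hcont : ContinuousOn (fun w : ℝ × ℝ => c ⌊w.1⌋ ⌊w.2⌋) C := by
      intro u hu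
      refine tendsto_nhds_of_eventually_eq ?_
      -- For `r'` near `r`, the closed unit interval starting at ⌊r'⌋ still contains `r`, so `step`
      -- applies at the centre point.
      have near : ∀ r : ℝ, ∀ᶠ r' in nhds r, ((⌊r'⌋ : ℤ) : ℝ) ≤ r ∧ r ≤ ((⌊r'⌋ : ℤ) : ℝ) + 1 := by
        intro r
        have h1 : (⌈r⌉ : ℝ) - 1 < r := by linarith [Int.ceil_lt_add_one r]
        have h2 : r < (⌊r⌋ : ℝ) + 1 := Int.lt_floor_add_one r
        filter_upwards [Ioo_mem_nhds h1 h2] with r' hr'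
        have e1 : ⌊r'⌋ ≤ ⌊r⌋ := by
          rw [← Int.lt_add_one_iff, Int.floor_lt]; push_cast; exact hr'.2
        have e2 : ⌈r⌉ - 1 ≤ ⌊r'⌋ := by
          rw [Int.le_floor]; push_cast; exact hr'.1.le
        constructor
        · exact (Int.cast_le.2 e1).trans (Int.floor_le r)
        · have : ((⌈r⌉ - 1 : ℤ) : ℝ) ≤ ((⌊r'⌋ : ℤ) : ℝ) := Int.cast_le.2 e2
          push_cast at this
          linarith [Int.le_ceil r]
      refine Filter.Eventually.filter_mono nhdsWithin_le_nhds ?_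
      filter_upwards [(continuous_fst.tendsto u).eventually (near u.1),
        (continuous_snd.tendsto u).eventually (near u.2)] with u' h1 h2
      exact step u (hCR hu) _ _ h1.1 h1.2 h2.1 h2.2
    have hconst : ∀ u ∈ C, c ⌊w.1⌋ ⌊w.2⌋ = c ⌊u.1⌋ ⌊u.2⌋ := fun u hu =>
      isPreconnected_connectedComponentIn.constant hcont hwC hu
    by_contra hne
    refine (notMem_loopRegion.1 hw).2 ?_
    refine (Bornology.IsBounded.prod (Metric.isBounded_Icc (-(N : ℝ)) (N + 1))
      (Metric.isBounded_Icc (-(N : ℝ)) (N + 1))).subset fun u hu => ?_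
    have h := hfar ⌊u.1⌋ ⌊u.2⌋ (by rw [← hconst u hu]; exact hne)
    rw [abs_le, abs_le] at h
    have conv : ∀ r : ℝ, -N ≤ ⌊r⌋ ∧ ⌊r⌋ ≤ N → r ∈ Icc (-(N : ℝ)) (N + 1) := by
      intro r hr
      refine ⟨?_, ?_⟩
      · have := Int.le_floor.1 hr.1
        push_cast at this
        exact this
      · have := Int.lt_floor_add_one r
        have h2 : ((⌊r⌋ : ℤ) : ℝ) ≤ N := Int.cast_le.2 hr.2
        linarith
    exact ⟨conv _ h.1, conv _ h.2⟩
  have inR : ∀ w : ℝ × ℝ, (x : ℝ) ≤ w.1 → w.1 ≤ x + 1 → (y : ℝ) ≤ w.2 → w.2 ≤ y + 1 →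
      w ∈ loopRegion α := by
    intro w h1 h2 h3 h4
    by_contra hw
    exact hxy ((step w hw x y h1 h2 h3 h4).trans (zero w hw))
  refine ⟨(hadj _ _).2 ⟨squareLattice_adj_right x y, fun w hw => ?_⟩,
    (hadj _ _).2 ⟨squareLattice_adj_up (x + 1) y, fun w hw => ?_⟩,
    (hadj _ _).2 ⟨squareLattice_adj_right x (y + 1), fun w hw => ?_⟩,
    (hadj _ _).2 ⟨squareLattice_adj_up x y, fun w hw => ?_⟩⟩
  · obtain ⟨h1, h2, h3⟩ := mem_segment_right.1 hw
    exact inR w h2 h3 (by linarith) (by linarith)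
  · obtain ⟨h1, h2, h3⟩ := mem_segment_up.1 hw
    push_cast at h1
    exact inR w (by linarith) (by linarith) h2 h3
  · obtain ⟨h1, h2, h3⟩ := mem_segment_right.1 hw
    push_cast at h1
    exact inR w h2 h3 (by linarith) (by linarith)
  · obtain ⟨h1, h2, h3⟩ := mem_segment_up.1 hw
    exact inR w (by linarith) (by linarith) h2 h3

end Subgraph

end GridGraph

/-! ### Face boundaries as a basis of flows, and the determinant formula -/

namespace GridGraph

open Set Matrix

/-- The upper or right end of the lattice edge with lower or left end `e.1`, which is vertical if
`e.2` is true and horizontal otherwise. -/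
def edgeHead (e : (ℤ × ℤ) × Bool) : ℤ × ℤ :=
  bif e.2 then (e.1.1, e.1.2 + 1) else (e.1.1 + 1, e.1.2)

@[simp] theorem edgeHead_right (p : ℤ × ℤ) : edgeHead (p, false) = (p.1 + 1, p.2) := rfl

@[simp] theorem edgeHead_up (p : ℤ × ℤ) : edgeHead (p, true) = (p.1, p.2 + 1) := rfl

theorem edgeHead_ne (e : (ℤ × ℤ) × Bool) : e.1 ≠ edgeHead e := by
  obtain ⟨⟨x, y⟩, _ | _⟩ := e <;> simp

theorem edge_injective :
    Function.Injective fun e : (ℤ × ℤ) × Bool => s(e.1, edgeHead e) := by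
  rintro ⟨⟨x, y⟩, _ | _⟩ ⟨⟨x', y'⟩, _ | _⟩ h <;>
    simp only [edgeHead_right, edgeHead_up, Sym2.eq_iff, Prod.mk.injEq, and_true,
      reduceCtorEq, and_false] at h ⊢ <;> omega

theorem exists_edge_of_adj {p q : ℤ × ℤ} (h : squareLattice.Adj p q) :
    ∃ e : (ℤ × ℤ) × Bool, (e.1 = p ∧ edgeHead e = q) ∨ (e.1 = q ∧ edgeHead e = p) := by
  rcases (squareLattice_adj_iff p q).1 h with h | h | h | h
  · exact ⟨(p, false), Or.inl ⟨rfl, h.symm⟩⟩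
  · exact ⟨(q, false), Or.inr ⟨rfl, h.symm⟩⟩
  · exact ⟨(p, true), Or.inl ⟨rfl, h.symm⟩⟩
  · exact ⟨(q, true), Or.inr ⟨rfl, h.symm⟩⟩

theorem edgeHead_eq_iff (e : (ℤ × ℤ) × Bool) (x y : ℤ) :
    edgeHead e = (x, y) ↔ e = ((x - 1, y), false) ∨ e = ((x, y - 1), true) := by
  obtain ⟨⟨a, b⟩, _ | _⟩ := e <;>
    simp only [edgeHead_right, edgeHead_up, Prod.mk.injEq, and_true, and_false,
      reduceCtorEq, or_false, false_or] <;> omega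

/-- The edges of `G`, oriented rightwards and upwards. -/
def orientedEdges (G : squareLattice.Subgraph) : Set ((ℤ × ℤ) × Bool) :=
  {e | G.Adj e.1 (edgeHead e)}

/-- The coefficient of the lattice edge `e` in the counterclockwise boundary of the face `f`. -/
def faceBoundary (f : ℤ × ℤ) (e : (ℤ × ℤ) × Bool) : ℤ :=
  (if e = (f, false) then 1 else 0) + (if e = ((f.1 + 1, f.2), true) then 1 else 0)
    - (if e = ((f.1, f.2 + 1), false) then 1 else 0) - (if e = (f, true) then 1 else 0)

theorem sum_subtype_mul_ite {β R : Type*} [CommRing R] [DecidableEq β] {S : Set β} [Fintype S]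
    (w : β → R)
    (a : β) (hw : a ∉ S → w a = 0) :
    ∑ x : S, w x * (if (x : β) = a then 1 else 0) = w a := by
  by_cases ha : a ∈ S
  · rw [Finset.sum_eq_single (⟨a, ha⟩ : S)]
    · simp
    · intro b _ hb
      rw [if_neg (fun h => hb (Subtype.ext h)), mul_zero]
    · simp
  · rw [hw ha]
    refine Finset.sum_eq_zero fun x _ => ?_
    rw [if_neg (fun h : (x : β) = a => ha (h ▸ x.2)), mul_zero]

variable (G : squareLattice.Subgraph)

/-- The tail of an oriented edge of `G`. -/
def src (e : orientedEdges G) : G.verts := ⟨e.1.1, G.edge_vert e.2⟩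

/-- The head of an oriented edge of `G`. -/
def tgt (e : orientedEdges G) : G.verts := ⟨edgeHead e.1, SimpleGraph.Subgraph.Adj.snd_mem e.2⟩

/-- The matrix of face boundaries. -/
def faceMatrix : Matrix (gridFaces G) (orientedEdges G) ℤ := fun f e => faceBoundary f e

variable {G}

theorem finite_orientedEdges (hfin : G.verts.Finite) : (orientedEdges G).Finite :=
  (hfin.prod (Set.finite_univ (α := Bool))).subset fun _ he => ⟨G.edge_vert he, mem_univ _⟩

theorem finite_gridFaces (hfin : G.verts.Finite) : (gridFaces G).Finite :=
  hfin.subset fun _ hp => G.edge_vert hp.1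

theorem src_tgt_injective : Function.Injective fun e => s(src G e, tgt G e) := by
  intro e e' h
  have := congrArg (Sym2.map Subtype.val) h
  exact Subtype.ext (edge_injective this)

theorem src_ne_tgt (e : orientedEdges G) : src G e ≠ tgt G e := fun h =>
  edgeHead_ne e.1 (congrArg Subtype.val h)

theorem edgeGraph_univ : EdgeParam.edgeGraph (src G) (tgt G) univ = G.coe := by
  ext ⟨p, hp⟩ ⟨q, hq⟩
  rw [EdgeParam.edgeGraph_adj src_ne_tgt, SimpleGraph.Subgraph.coe_adj]
  constructor
  · rintro ⟨⟨e, he⟩, -, ⟨h1, h2⟩ | ⟨h1, h2⟩⟩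
    · rw [← congrArg Subtype.val h1, ← congrArg Subtype.val h2]; exact he
    · rw [← congrArg Subtype.val h1, ← congrArg Subtype.val h2]; exact SimpleGraph.Subgraph.Adj.symm he
  · intro h
    obtain ⟨e, ⟨rfl, rfl⟩ | ⟨rfl, rfl⟩⟩ := exists_edge_of_adj h.adj_sub
    · exact ⟨⟨e, h⟩, trivial, Or.inl ⟨rfl, rfl⟩⟩
    · exact ⟨⟨e, SimpleGraph.Subgraph.Adj.symm h⟩, trivial, Or.inr ⟨rfl, rfl⟩⟩

theorem sum_faceBoundary_mul [Fintype (orientedEdges G)] {f : ℤ × ℤ} (hf : f ∈ gridFaces G)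
    (g : (ℤ × ℤ) × Bool → ℤ) :
    ∑ e : orientedEdges G, faceBoundary f e * g e =
      g (f, false) + g ((f.1 + 1, f.2), true) - g ((f.1, f.2 + 1), false) - g (f, true) := by
  obtain ⟨h1, h2, h3, h4⟩ := hf
  rw [← sum_subtype_mul_ite (S := orientedEdges G) g (f, false) (fun h => absurd h1 h),
    ← sum_subtype_mul_ite (S := orientedEdges G) g ((f.1 + 1, f.2), true)
      (fun h => absurd h2 h),
    ← sum_subtype_mul_ite (S := orientedEdges G) g ((f.1, f.2 + 1), false)
      (fun h => absurd h3 h),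
    ← sum_subtype_mul_ite (S := orientedEdges G) g (f, true) (fun h => absurd h4 h)]
  rw [← Finset.sum_add_distrib, ← Finset.sum_sub_distrib, ← Finset.sum_sub_distrib]
  refine Finset.sum_congr rfl fun e _ => ?_
  simp only [faceBoundary]
  ring

theorem ite_edgeHead (e : (ℤ × ℤ) × Bool) (x y : ℤ) :
    (if edgeHead e = (x, y) then (1 : ℤ) else 0) =
      (if e = ((x - 1, y), false) then 1 else 0) + (if e = ((x, y - 1), true) then 1 else 0) := by
  by_cases h1 : e = ((x - 1, y), false)
  · subst h1; simp
  · by_cases h2 : e = ((x, y - 1), true)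
    · subst h2; simp
    · rw [if_neg h1, if_neg h2, if_neg]
      · rfl
      · rw [edgeHead_eq_iff]; tauto

theorem ite_tail (e : (ℤ × ℤ) × Bool) (p : ℤ × ℤ) :
    (if e.1 = p then (1 : ℤ) else 0) =
      (if e = (p, false) then 1 else 0) + (if e = (p, true) then 1 else 0) := by
  obtain ⟨q, _ | _⟩ := e <;> simp

theorem inflow_eq [Fintype (orientedEdges G)] (z : orientedEdges G → ℤ) (w : (ℤ × ℤ) × Bool → ℤ)
    (hzw : ∀ e : orientedEdges G, w e = z e) (hw : ∀ e ∉ orientedEdges G, w e = 0)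
    {x y : ℤ} (hp : (x, y) ∈ G.verts) :
    EdgeParam.inflow (src G) (tgt G) z ⟨(x, y), hp⟩ =
      w ((x - 1, y), false) - w ((x, y), false) + w ((x, y - 1), true) - w ((x, y), true) := by
  rw [← sum_subtype_mul_ite (S := orientedEdges G) w ((x - 1, y), false) (hw _),
    ← sum_subtype_mul_ite (S := orientedEdges G) w ((x, y), false) (hw _),
    ← sum_subtype_mul_ite (S := orientedEdges G) w ((x, y - 1), true) (hw _),
    ← sum_subtype_mul_ite (S := orientedEdges G) w ((x, y), true) (hw _)]
  rw [← Finset.sum_sub_distrib, ← Finset.sum_add_distrib, ← Finset.sum_sub_distrib]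
  refine Finset.sum_congr rfl fun e _ => ?_
  have h1 : (tgt G e = ⟨(x, y), hp⟩) = (edgeHead e = (x, y)) := by
    rw [Subtype.ext_iff]; rfl
  have h2 : (src G e = ⟨(x, y), hp⟩) = ((e : (ℤ × ℤ) × Bool).1 = (x, y)) := by
    rw [Subtype.ext_iff]; rfl
  simp only [h1, h2, ite_edgeHead, ite_tail, hzw]
  ring

theorem inflow_faceMatrix [Fintype (orientedEdges G)] (f : gridFaces G) (v : G.verts) :
    EdgeParam.inflow (src G) (tgt G) (faceMatrix G f) v = 0 := by
  have h := sum_faceBoundary_mul f.2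
    fun e => (if edgeHead e = v.1 then 1 else 0) - (if e.1 = v.1 then 1 else 0)
  have h' : EdgeParam.inflow (src G) (tgt G) (faceMatrix G f) v =
      ∑ e : orientedEdges G, faceBoundary f e *
        ((if edgeHead e.1 = v.1 then 1 else 0) - (if e.1.1 = v.1 then 1 else 0)) := by
    refine Finset.sum_congr rfl fun e _ => ?_
    have h1 : (tgt G e = v) = (edgeHead e = v.1) := by rw [Subtype.ext_iff]; rfl
    have h2 : (src G e = v) = ((e : (ℤ × ℤ) × Bool).1 = v.1) := by rw [Subtype.ext_iff]; rfl
    simp only [h1, h2]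
    rfl
  rw [h', h]
  simp only [edgeHead_right, edgeHead_up]
  ring_nf

/-- An edge borders two squares and is traversed in opposite directions by their boundaries.
Extending `c` by zero to `C` covers edges with a side that is not a face. -/
theorem vecMul_faceMatrix [Fintype (gridFaces G)] (c : gridFaces G → ℤ) (C : ℤ → ℤ → ℤ)
    (hcC : ∀ f : gridFaces G, C f.1.1 f.1.2 = c f) (hC : ∀ x y, (x, y) ∉ gridFaces G → C x y = 0)
    (e : orientedEdges G) :
    (c ᵥ* faceMatrix G) e = bif e.1.2 then C (e.1.1.1 - 1) e.1.1.2 - C e.1.1.1 e.1.1.2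
      else C e.1.1.1 e.1.1.2 - C e.1.1.1 (e.1.1.2 - 1) := by
  have hS := fun x y => sum_subtype_mul_ite (S := gridFaces G) (fun f => C f.1 f.2) (x, y) (hC x y)
  simp only [Matrix.vecMul, dotProduct]
  obtain ⟨⟨⟨x, y⟩, b⟩, he⟩ := e
  cases b
  · simp only [cond_false]
    rw [← hS x y, ← hS x (y - 1), ← Finset.sum_sub_distrib]
    refine Finset.sum_congr rfl fun f _ => ?_
    obtain ⟨⟨a, b⟩, hf⟩ := f
    simp only [← hcC, faceMatrix, faceBoundary, Prod.mk.injEq, and_true, and_false, reduceCtorEq,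
      if_false]
    rw [← mul_sub]
    congr 1
    have e1 : (x = a ∧ y = b) = (a = x ∧ b = y) := by apply propext; omega
    have e2 : (x = a ∧ y = b + 1) = (a = x ∧ b = y - 1) := by apply propext; omega
    simp only [e1, e2]
    ring
  · simp only [cond_true]
    rw [← hS (x - 1) y, ← hS x y, ← Finset.sum_sub_distrib]
    refine Finset.sum_congr rfl fun f _ => ?_
    obtain ⟨⟨a, b⟩, hf⟩ := f
    simp only [← hcC, faceMatrix, faceBoundary, Prod.mk.injEq, and_true, and_false, reduceCtorEq,
      if_false]
    rw [← mul_sub]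
    congr 1
    have e1 : (x = a ∧ y = b) = (a = x ∧ b = y) := by apply propext; omega
    have e2 : (x = a + 1 ∧ y = b) = (a = x - 1 ∧ b = y) := by apply propext; omega
    simp only [e1, e2]
    ring

open Classical in
-- If the combination vanishes, the coefficients are constant along each column of squares, and the
-- finitely many faces leave a zero in every column.
theorem faceMatrix_rows_independent [Fintype (gridFaces G)] (c : gridFaces G → ℤ)
    (h : c ᵥ* faceMatrix G = 0) : c = 0 := by
  set C : ℤ → ℤ → ℤ := fun x y => if hf : (x, y) ∈ gridFaces G then c ⟨(x, y), hf⟩ else 0 with hCdef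
  have hC : ∀ x y, (x, y) ∉ gridFaces G → C x y = 0 := fun x y hf => dif_neg hf
  have hcC : ∀ f : gridFaces G, C f.1.1 f.1.2 = c f := fun f => dif_pos f.2
  have hrow : ∀ x y, C x y = C x (y - 1) := by
    intro x y
    by_cases he : ((x, y), false) ∈ orientedEdges G
    · have h1 := vecMul_faceMatrix c C hcC hC ⟨_, he⟩
      rw [h] at h1
      simp only [Pi.zero_apply, cond_false] at h1
      linarith
    -- A missing horizontal edge prevents both squares adjacent to it from being faces.
    · rw [hC x y fun hf => he hf.1, hC x (y - 1) fun hf => he ?_]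
      have := hf.2.2.1
      simp only [sub_add_cancel] at this
      exact this
  obtain ⟨N, hN⟩ := ((Set.toFinite (gridFaces G)).image Prod.snd).bddAbove
  funext f
  rw [← hcC f, eq_of_forall_eq_pred (hrow f.1.1) f.1.2 (N + 1), hC]
  · rfl
  · intro hf
    have := hN ⟨_, hf, rfl⟩
    simp only at this
    omega

/-- The faces of `G` span its integer flows. -/
def FacesSpan (G : squareLattice.Subgraph) : Prop :=
  ∀ (N : ℤ) (h v : ℤ → ℤ → ℤ),
    (∀ x y, h x y ≠ 0 → |x| ≤ N ∧ |y| ≤ N) → (∀ x y, v x y ≠ 0 → |x| ≤ N ∧ |y| ≤ N) →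
    (∀ x y, ¬ G.Adj (x, y) (x + 1, y) → h x y = 0) →
    (∀ x y, ¬ G.Adj (x, y) (x, y + 1) → v x y = 0) →
    (∀ x y, h (x - 1) y - h x y + v x (y - 1) - v x y = 0) →
    ∃ c : ℤ → ℤ → ℤ, (∀ x y, h x y = c x y - c x (y - 1)) ∧
      (∀ x y, v x y = c (x - 1) y - c x y) ∧ ∀ x y, (x, y) ∉ gridFaces G → c x y = 0

/-- The potential of the flow on the whole plane is constant across edges missing from `G`, because
the flow is zero there, so it lives on the faces of `G`. -/
theorem facesSpan_of_isSimpleGridGraph (hG : IsSimpleGridGraph G) : FacesSpan G := by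
  obtain ⟨v₀, α, hα, hverts, hadj⟩ := hG
  intro N h v hh hv hGh hGv hdiv
  obtain ⟨c, hc1, hc2, hc3⟩ := exists_potential hh hv hdiv
  refine ⟨c, hc1, hc2, fun x y hf => ?_⟩
  by_contra hne
  refine hf (mem_gridFaces_of_ne_zero hadj (c := c) (N := N) (fun x y hA => ?_) (fun x y hA => ?_)
    hc3 hne)
  · have := hc1 x y
    rw [hGh x y hA] at this
    linarith
  · have := hc2 x y
    rw [hGv x y hA] at this
    linarith

theorem coe_connected (hG : IsSimpleGridGraph G) : G.coe.Connected := by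
  obtain ⟨v₀, α, hα, hverts, hadj⟩ := hG
  exact coe_connected_of_loop hverts hadj hα.not_nil

theorem verts_finite (hG : IsSimpleGridGraph G) : G.verts.Finite := by
  obtain ⟨v₀, α, hα, hverts, hadj⟩ := hG
  obtain ⟨N, hN⟩ := exists_box α
  refine ((finite_Icc (-N) N).prod (finite_Icc (-N) N)).subset fun p hp => ?_
  have := loopRegion_subset_box hN ((hverts p).1 hp)
  simp only [latticePoint, abs_le] at this
  exact_mod_cast this

open Classical in
-- Extend the flow by zero to all lattice edges; at points that are not vertices of `G` every
-- incident edge carries zero.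
theorem exists_vecMul_eq [Fintype (gridFaces G)] [Fintype (orientedEdges G)]
    (hspan : FacesSpan G) (z : orientedEdges G → ℤ)
    (hz : ∀ v, EdgeParam.inflow (src G) (tgt G) z v = 0) : ∃ c, z = c ᵥ* faceMatrix G := by
  set w : (ℤ × ℤ) × Bool → ℤ := fun e => if he : e ∈ orientedEdges G then z ⟨e, he⟩ else 0
  have hzw : ∀ e : orientedEdges G, w e = z e := fun e => dif_pos e.2
  have hw : ∀ e ∉ orientedEdges G, w e = 0 := fun e he => dif_neg he
  obtain ⟨N, hN⟩ := ((Set.toFinite (orientedEdges G)).image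
    fun e => max |e.1.1| |e.1.2|).bddAbove
  have hbox : ∀ x y b, w ((x, y), b) ≠ 0 → |x| ≤ N ∧ |y| ≤ N := by
    intro x y b h
    have he : ((x, y), b) ∈ orientedEdges G := by
      by_contra he
      exact h (hw _ he)
    have := hN ⟨_, he, rfl⟩
    simpa using this
  obtain ⟨C, h1, h2, h3⟩ := hspan N (fun x y => w ((x, y), false)) (fun x y => w ((x, y), true))
    (fun x y => hbox x y false) (fun x y => hbox x y true) (fun x y h => hw _ h)
    (fun x y h => hw _ h) (fun x y => by
      by_cases hp : (x, y) ∈ G.verts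
      · rw [← inflow_eq z w hzw hw hp, hz]
      · rw [hw ((x - 1, y), false) fun he => hp ?_, hw ((x, y), false) fun he => hp ?_,
          hw ((x, y - 1), true) fun he => hp ?_, hw ((x, y), true) fun he => hp ?_]
        · ring
        · exact G.edge_vert he
        · simpa using SimpleGraph.Subgraph.Adj.snd_mem he
        · exact G.edge_vert he
        · simpa using SimpleGraph.Subgraph.Adj.snd_mem he)
  refine ⟨fun f => C f.1.1 f.1.2, ?_⟩
  funext e
  rw [vecMul_faceMatrix _ C (fun f => rfl) h3, ← hzw]
  obtain ⟨⟨⟨x, y⟩, _ | _⟩, he⟩ := e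
  · exact h1 x y
  · exact h2 x y

/-- Euler's formula for simple grid graphs. -/
theorem euler_formula (hG : IsSimpleGridGraph G) :
    gridArea G + G.verts.ncard = (orientedEdges G).ncard + 1 := by
  classical
  have hfin := verts_finite hG
  have := hfin.fintype
  have := (finite_orientedEdges hfin).fintype
  have := (finite_gridFaces hfin).fintype
  have h := EdgeParam.card_add_card_eq (s := src G) (t := tgt G) src_tgt_injective src_ne_tgt
    inflow_faceMatrix faceMatrix_rows_independent
    (exists_vecMul_eq (facesSpan_of_isSimpleGridGraph hG))
    (by rw [edgeGraph_univ]; exact coe_connected hG)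
  rwa [← Nat.card_eq_fintype_card, ← Nat.card_eq_fintype_card, ← Nat.card_eq_fintype_card] at h

open Classical in
/-- The adjacency matrix of the set `D` of faces. -/
noncomputable def cellAdj (D : Set (ℤ × ℤ)) : Matrix D D ℝ :=
  fun p q => if squareLattice.Adj p.1 q.1 then 1 else 0

open Classical in
-- A boundary consists of four edges with signs ±1; neighbouring faces share one edge with opposite
-- signs, and all other pairs share none.
theorem faceMatrix_mul_transpose [Fintype (orientedEdges G)] (f f' : gridFaces G) :
    (faceMatrix G * (faceMatrix G)ᵀ) f f' =
      (if f = f' then 4 else 0) - (if squareLattice.Adj f.1 f'.1 then 1 else 0) := by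
  rw [Matrix.mul_apply]
  have h := sum_faceBoundary_mul f.2 (faceBoundary f')
  refine (show _ = _ from h).trans ?_
  obtain ⟨⟨a, b⟩, hf⟩ := f
  obtain ⟨⟨c, d⟩, hf'⟩ := f'
  simp only [faceBoundary, Prod.mk.injEq, and_true, and_false, reduceCtorEq, if_false,
    squareLattice_adj_iff, Subtype.mk.injEq]
  clear h hf hf'
  -- Only the relative position `(u, v)` matters, and squares further than one step apart in some
  -- coordinate share nothing.
  obtain ⟨u, rfl⟩ : ∃ u, c = a + u := ⟨c - a, by ring⟩
  obtain ⟨v, rfl⟩ : ∃ v, d = b + v := ⟨d - b, by ring⟩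
  have cases : (u = 0 ∧ v = 0) ∨ (u = 1 ∧ v = 0) ∨ (u = -1 ∧ v = 0) ∨ (u = 0 ∧ v = 1) ∨
      (u = 0 ∧ v = -1) ∨ (u = 1 ∧ v = 1) ∨ (u = 1 ∧ v = -1) ∨ (u = -1 ∧ v = 1) ∨
      (u = -1 ∧ v = -1) ∨ (u < -1 ∨ 1 < u ∨ v < -1 ∨ 1 < v) := by omega
  rcases cases with ⟨rfl, rfl⟩ | ⟨rfl, rfl⟩ | ⟨rfl, rfl⟩ | ⟨rfl, rfl⟩ | ⟨rfl, rfl⟩ | ⟨rfl, rfl⟩ |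
    ⟨rfl, rfl⟩ | ⟨rfl, rfl⟩ | ⟨rfl, rfl⟩ | hfar
  case' inr.inr.inr.inr.inr.inr.inr.inr.inr =>
    rw [if_neg (show ¬(a = a + u ∧ b = b + v) by omega),
      if_neg (show ¬(a = a + u ∧ b = b + v + 1) by omega),
      if_neg (show ¬(a + 1 = a + u + 1 ∧ b = b + v) by omega),
      if_neg (show ¬(a + 1 = a + u ∧ b = b + v) by omega),
      if_neg (show ¬(a = a + u ∧ b + 1 = b + v) by omega),
      if_neg (show ¬(a = a + u ∧ b + 1 = b + v + 1) by omega),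
      if_neg (show ¬(a = a + u + 1 ∧ b = b + v) by omega), if_neg (by omega)]
  all_goals simp
  all_goals omega

theorem numSpanningTrees_eq_det (hG : IsSimpleGridGraph G) [Fintype (gridFaces G)]
    [DecidableEq (gridFaces G)] :
    (numSpanningTrees G : ℝ) = ((4 : ℝ) • 1 - cellAdj (gridFaces G)).det := by
  classical
  have hfin := verts_finite hG
  have := hfin.fintype
  have := (finite_orientedEdges hfin).fintype
  have h := EdgeParam.ncard_spanningTrees_eq_det (s := src G) (t := tgt G) src_tgt_injective
    src_ne_tgt inflow_faceMatrix faceMatrix_rows_independent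
    (exists_vecMul_eq (facesSpan_of_isSimpleGridGraph hG))
    (by rw [edgeGraph_univ]; exact coe_connected hG)
  rw [edgeGraph_univ] at h
  have h2 : (numSpanningTrees G : ℝ) =
      (((faceMatrix G * (faceMatrix G)ᵀ).det : ℤ) : ℝ) := by
    rw [← h, Int.cast_natCast, numSpanningTrees]
  rw [h2, Int.cast_det]
  congr 1
  ext f f'
  rw [Matrix.map_apply, faceMatrix_mul_transpose]
  simp only [cellAdj, Matrix.sub_apply, Matrix.smul_apply, Matrix.one_apply, smul_eq_mul]
  push_cast
  simp

end GridGraph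

/-! ### The analytic estimate behind the constant 4C/π -/

namespace GridGraph

open Real Set Filter Topology

/-! ### Catalan's constant as an integral -/

/-- Real part of the Taylor series of log(1 + z) at z = r exp(2iu), with |1 + z|² computed
explicitly. The term n = 0 is zero, by division by zero. -/
theorem hasSum_half_log {r u : ℝ} (hr0 : 0 ≤ r) (hr1 : r < 1) :
    HasSum (fun n : ℕ => (-1 : ℝ) ^ (n + 1) * r ^ n / n * cos (2 * n * u))
      (1 / 2 * log (1 + 2 * r * cos (2 * u) + r ^ 2)) := by
  set z : ℂ := r * Complex.exp ((2 * u : ℝ) * Complex.I) with hz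
  have hzn : ‖z‖ < 1 := by
    rw [hz, norm_mul, Complex.norm_exp_ofReal_mul_I, mul_one, Complex.norm_real,
      Real.norm_of_nonneg hr0]
    exact hr1
  have h := Complex.hasSum_re (Complex.hasSum_taylorSeries_log hzn)
  have hre : (Complex.log (1 + z)).re = 1 / 2 * log (1 + 2 * r * cos (2 * u) + r ^ 2) := by
    have h1 : Complex.normSq (1 + z) = 1 + 2 * r * cos (2 * u) + r ^ 2 := by
      rw [Complex.normSq_apply, hz]
      simp only [Complex.add_re, Complex.add_im, Complex.one_re, Complex.one_im,
        Complex.re_ofReal_mul, Complex.im_ofReal_mul, Complex.exp_ofReal_mul_I_re,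
        Complex.exp_ofReal_mul_I_im]
      linear_combination r ^ 2 * sin_sq_add_cos_sq (2 * u)
    rw [Complex.log_re, ← h1, Complex.normSq_eq_norm_sq, Real.log_pow]
    push_cast
    ring
  rw [hre] at h
  convert h using 2 with n
  have hzp : (-1 : ℂ) ^ (n + 1) * z ^ n / n =
      (((-1 : ℝ) ^ (n + 1) * r ^ n / n : ℝ) : ℂ) *
        Complex.exp ((2 * n * u : ℝ) * Complex.I) := by
    rw [hz, mul_pow, ← Complex.exp_nat_mul]
    push_cast
    rw [show (n : ℂ) * (2 * u * Complex.I) = 2 * n * u * Complex.I by ring]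
    ring
  rw [hzp, Complex.re_ofReal_mul, Complex.exp_ofReal_mul_I_re]

theorem integral_cos_two_mul (n : ℕ) (hn : n ≠ 0) :
    ∫ u in (0 : ℝ)..π / 4, cos (2 * n * u) = sin (n * (π / 2)) / (2 * n) := by
  have hn' : (2 * n : ℝ) ≠ 0 := by positivity
  rw [intervalIntegral.integral_comp_mul_left (fun x => cos x) hn', integral_cos]
  rw [mul_zero, sin_zero, sub_zero, smul_eq_mul, inv_mul_eq_div]
  congr 2
  ring

/-- The terms of the integrated Fourier series of `log |1 + r exp (2iu)|`. -/
noncomputable def catalanTerm (n : ℕ) (r : ℝ) : ℝ := (-1) ^ (n + 1) * r ^ n / n * (sin (n * (π / 2)) / (2 * n))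

theorem one_le_arg {r u : ℝ} (hr0 : 0 ≤ r) (hu : u ∈ uIcc 0 (π / 4)) :
    1 ≤ 1 + 2 * r * cos (2 * u) + r ^ 2 := by
  rw [uIcc_of_le (by positivity)] at hu
  have : 0 ≤ cos (2 * u) := cos_nonneg_of_mem_Icc ⟨by linarith [hu.1, pi_pos], by linarith [hu.2]⟩
  have := mul_nonneg hr0 this
  nlinarith [sq_nonneg r]

theorem hasSum_catalanTerm {r : ℝ} (hr0 : 0 ≤ r) (hr1 : r < 1) :
    HasSum (fun n => catalanTerm n r)
      (∫ u in (0 : ℝ)..π / 4, 1 / 2 * log (1 + 2 * r * cos (2 * u) + r ^ 2)) := by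
  have h := intervalIntegral.hasSum_integral_of_dominated_convergence (μ := MeasureTheory.volume)
    (a := 0) (b := π / 4) (F := fun (n : ℕ) u => (-1 : ℝ) ^ (n + 1) * r ^ n / n * cos (2 * n * u))
    (f := fun u => 1 / 2 * log (1 + 2 * r * cos (2 * u) + r ^ 2)) (fun n _ => r ^ n)
    (fun n => by
      refine Continuous.aestronglyMeasurable ?_
      fun_prop)
    (fun n => MeasureTheory.ae_of_all _ fun u _ => by
      rw [norm_mul, norm_div, norm_mul, norm_pow, norm_neg, norm_one, one_pow, one_mul,
        Real.norm_of_nonneg (pow_nonneg hr0 n), Real.norm_natCast]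
      have h1 : ‖cos (2 * n * u)‖ ≤ 1 := abs_cos_le_one _
      have h2 : r ^ n / n ≤ r ^ n := by
        rcases Nat.eq_zero_or_pos n with rfl | hn
        · simp
        · exact div_le_self (pow_nonneg hr0 n) (by exact_mod_cast hn)
      calc r ^ n / n * ‖cos (2 * n * u)‖ ≤ r ^ n / n * 1 := by gcongr
        _ ≤ r ^ n := by linarith)
    (MeasureTheory.ae_of_all _ fun u _ => summable_geometric_of_lt_one hr0 hr1)
    (by simp)
    (MeasureTheory.ae_of_all _ fun u _ => hasSum_half_log hr0 hr1)
  refine (congrArg (HasSum · _ _) (funext fun n => ?_)).mpr h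
  rw [intervalIntegral.integral_const_mul, catalanTerm]
  rcases eq_or_ne n 0 with rfl | hn
  · simp
  · rw [integral_cos_two_mul n hn]

/-- sin(nπ/2) vanishes for even n and equals (−1)^m for n = 2m + 1. -/
theorem tsum_catalanTerm_one : ∑' n, catalanTerm n 1 = catalanC / 2 := by
  have hinj : Function.Injective fun m : ℕ => 2 * m + 1 := fun a b h => by
    simp only at h; omega
  have hsupp : Function.support (fun n => catalanTerm n 1) ⊆ range fun m : ℕ => 2 * m + 1 := by
    intro n hn
    by_contra hno
    apply hn
    obtain ⟨k, rfl | rfl⟩ := Nat.even_or_odd' n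
    · have : sin (((2 * k : ℕ) : ℝ) * (π / 2)) = 0 := by
        rw [show ((2 * k : ℕ) : ℝ) * (π / 2) = k * π by push_cast; ring]
        exact sin_nat_mul_pi k
      simp only [catalanTerm, this]
      simp
    · exact absurd ⟨k, rfl⟩ hno
  rw [← hinj.tsum_eq hsupp, catalanC, ← tsum_div_const]
  congr 1
  funext m
  have h1 : sin (((2 * m + 1 : ℕ) : ℝ) * (π / 2)) = (-1) ^ m := by
    rw [show ((2 * m + 1 : ℕ) : ℝ) * (π / 2) = π / 2 + m * π by push_cast; ring]
    rw [sin_add_nat_mul_pi, sin_pi_div_two, mul_one]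
  simp only [catalanTerm, h1]
  have h2 : (-1 : ℝ) ^ (2 * m + 1 + 1) = 1 := by
    rw [show 2 * m + 1 + 1 = 2 * (m + 1) by ring, pow_mul]; simp
  rw [h2]
  push_cast
  have : (2 * (m : ℝ) + 1) ≠ 0 := by positivity
  field_simp
  exact one_pow _

/-- Abel summation: the series and the integral agree for r < 1 and are both continuous up to r = 1,
where |1 + exp(2iu)| = 2 cos u. -/
theorem integral_log_two_cos :
    ∫ u in (0 : ℝ)..π / 4, log (2 * cos u) = catalanC / 2 := by
  -- The maximum with 1 changes nothing for r ≥ 0 and makes the integrand continuous for all real r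
  -- and u.
  set Φ : ℝ → ℝ := fun r => ∫ u in (0 : ℝ)..π / 4,
    1 / 2 * log (max 1 (1 + 2 * r * cos (2 * u) + r ^ 2)) with hΦ
  have hΦc : Continuous Φ := by
    refine intervalIntegral.continuous_parametric_intervalIntegral_of_continuous' ?_ _ _
    refine continuous_const.mul (Continuous.log ?_ fun p => ?_)
    · fun_prop
    · exact (lt_of_lt_of_le one_pos (le_max_left _ _)).ne'
  have hΦeq : ∀ r, 0 ≤ r → Φ r =
      ∫ u in (0 : ℝ)..π / 4, 1 / 2 * log (1 + 2 * r * cos (2 * u) + r ^ 2) := by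
    intro r hr
    refine intervalIntegral.integral_congr fun u hu => ?_
    rw [max_eq_right (one_le_arg hr hu)]
  have hS : ContinuousOn (fun r => ∑' n, catalanTerm n r) (Icc 0 1) := by
    refine continuousOn_tsum (u := fun n : ℕ => 1 / (n : ℝ) ^ 2) (fun n => ?_)
      (Real.summable_one_div_nat_pow.2 (by norm_num)) fun n r hr => ?_
    · unfold catalanTerm
      fun_prop
    · unfold catalanTerm
      rcases Nat.eq_zero_or_pos n with rfl | hn
      · simp
      have hn' : (0 : ℝ) < n := by exact_mod_cast hn
      rw [norm_mul, norm_div, norm_div, norm_mul, norm_pow, norm_neg, norm_one, one_pow, one_mul,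
        Real.norm_of_nonneg (pow_nonneg hr.1 n), Real.norm_natCast,
        Real.norm_of_nonneg (by positivity : (0 : ℝ) ≤ 2 * n)]
      have h1 : ‖sin (n * (π / 2))‖ ≤ 1 := abs_sin_le_one _
      have h2 : r ^ n ≤ 1 := pow_le_one₀ hr.1 hr.2
      calc r ^ n / n * (‖sin (n * (π / 2))‖ / (2 * n)) ≤ 1 / n * (1 / (1 * n)) := by
            gcongr
            norm_num
        _ = 1 / (n : ℝ) ^ 2 := by rw [one_mul, one_div_mul_one_div, sq]
  have hlim1 : Tendsto Φ (𝓝[<] 1) (𝓝 (Φ 1)) := hΦc.continuousAt.tendsto.mono_left nhdsWithin_le_nhds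
  have hlim2 : Tendsto Φ (𝓝[<] 1) (𝓝 (∑' n, catalanTerm n 1)) := by
    have h1 : Tendsto (fun r => ∑' n, catalanTerm n r) (𝓝[Ico 0 1] 1) (𝓝 (∑' n, catalanTerm n 1)) :=
      (hS 1 (right_mem_Icc.2 zero_le_one)).mono_left (nhdsWithin_mono _ Ico_subset_Icc_self)
    rw [nhdsWithin_Ico_eq_nhdsLT zero_lt_one] at h1
    refine h1.congr' ?_
    filter_upwards [Ico_mem_nhdsLT (zero_lt_one (α := ℝ))] with r hr
    rw [hΦeq r hr.1]
    exact (hasSum_catalanTerm hr.1 hr.2).tsum_eq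
  rw [← tsum_catalanTerm_one, ← tendsto_nhds_unique hlim1 hlim2, hΦeq 1 zero_le_one]
  refine intervalIntegral.integral_congr fun u hu => ?_
  rw [uIcc_of_le (by positivity)] at hu
  have hc : 0 < cos u := cos_pos_of_mem_Ioo ⟨by linarith [hu.1, pi_pos], by linarith [hu.2, pi_pos]⟩
  have : 1 + 2 * 1 * cos (2 * u) + 1 ^ 2 = (2 * cos u) ^ 2 := by rw [cos_two_mul]; ring
  rw [this, Real.log_pow]
  push_cast
  ring

/-- On [0, π/4] one has 2 cos u ≥ √2 > 1, so the integral of the logarithm is positive. -/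
theorem catalanC_pos : 0 < catalanC := by
  have h := integral_log_two_cos
  have hcos : ∀ u ∈ Icc (0 : ℝ) (π / 4), 1 < 2 * cos u := by
    intro u hu
    have h1 : cos (π / 4) ≤ cos u :=
      cos_le_cos_of_nonneg_of_le_pi hu.1 (by linarith [pi_pos]) hu.2
    rw [cos_pi_div_four] at h1
    have : (1 : ℝ) < √2 := by rw [lt_sqrt] <;> norm_num
    linarith
  have hpos : 0 < ∫ u in (0 : ℝ)..π / 4, log (2 * cos u) := by
    refine intervalIntegral.intervalIntegral_pos_of_pos_on ?_ (fun u hu => ?_) (by positivity)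
    · refine ContinuousOn.intervalIntegrable ?_
      rw [uIcc_of_le (by positivity)]
      exact ContinuousOn.log (by fun_prop) fun u hu => (by linarith [hcos u hu] : 2 * cos u ≠ 0)
    · exact log_pos (hcos u ⟨hu.1.le, hu.2.le⟩)
  linarith

/-- `∫₀^{π/2} log ((1 + sin θ) / 2) dθ = 2 C - π log 2`. -/
theorem integral_log_one_add_sin :
    ∫ θ in (0 : ℝ)..π / 2, log ((1 + sin θ) / 2) = 2 * catalanC - π * log 2 := by
  have h1 : ∫ θ in (0 : ℝ)..π / 2, log ((1 + sin θ) / 2) =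
      ∫ θ in (0 : ℝ)..π / 2, (fun u => 2 * log (2 * cos u) - 2 * log 2) (π / 4 - θ / 2) := by
    refine intervalIntegral.integral_congr fun θ hθ => ?_
    rw [uIcc_of_le (by positivity)] at hθ
    have hc : 0 < cos (π / 4 - θ / 2) :=
      cos_pos_of_mem_Ioo ⟨by linarith [hθ.2, pi_pos], by linarith [hθ.1, pi_pos]⟩
    have h2 : (1 + sin θ) / 2 = cos (π / 4 - θ / 2) ^ 2 := by
      rw [cos_sq, show 2 * (π / 4 - θ / 2) = π / 2 - θ by ring, cos_pi_div_two_sub]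
      ring
    simp only
    rw [h2, Real.log_pow, Real.log_mul two_ne_zero hc.ne']
    push_cast
    ring
  rw [h1, intervalIntegral.integral_comp_sub_div (fun u => 2 * log (2 * cos u) - 2 * log 2)
    two_ne_zero]
  rw [show π / 4 - π / 2 / 2 = 0 by ring, show π / 4 - 0 / 2 = π / 4 by ring]
  rw [intervalIntegral.integral_sub, intervalIntegral.integral_const_mul, integral_log_two_cos]
  · simp only [intervalIntegral.integral_const, smul_eq_mul]
    ring
  · refine (ContinuousOn.intervalIntegrable ?_).const_mul 2
    rw [uIcc_of_le (by positivity)]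
    refine ContinuousOn.log (by fun_prop) fun u hu => ?_
    have : 0 < cos u :=
      cos_pos_of_mem_Ioo ⟨by linarith [hu.1, pi_pos], by linarith [hu.2, pi_pos]⟩
    positivity
  · simp

/-! ### Moments of the cosine -/

/-- The average of `cos ^ k` over a period. -/
noncomputable def cosMoment (k : ℕ) : ℝ := 1 / π * ∫ θ in (0 : ℝ)..π, cos θ ^ k

theorem cosMoment_zero : cosMoment 0 = 1 := by
  simp [cosMoment, pi_ne_zero]

theorem cosMoment_one : cosMoment 1 = 0 := by
  simp [cosMoment]

theorem cosMoment_add_two (k : ℕ) : cosMoment (k + 2) = (k + 1) / (k + 2) * cosMoment k := by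
  simp only [cosMoment]
  rw [integral_cos_pow]
  simp
  ring

theorem cosMoment_nonneg : ∀ k, 0 ≤ cosMoment k
  | 0 => by rw [cosMoment_zero]; exact zero_le_one
  | 1 => by rw [cosMoment_one]
  | k + 2 => by rw [cosMoment_add_two]; exact mul_nonneg (by positivity) (cosMoment_nonneg k)

/-- For odd k the moment is zero; for even k it equals the average over [0, π/2]. The extra factor
covers both parities and leaves an integral on which cos is nonnegative. -/
theorem cosMoment_mul_self : ∀ k, cosMoment k * cosMoment k =
    cosMoment k * (2 / π * ∫ θ in (0 : ℝ)..π / 2, cos θ ^ k)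
  | 0 => by
    rw [cosMoment_zero]
    simp
  | 1 => by rw [cosMoment_one]; simp
  | k + 2 => by
    have ih := cosMoment_mul_self k
    rw [cosMoment_add_two, integral_cos_pow]
    simp only [cos_pi_div_two, sin_zero, mul_zero, sub_zero]
    rw [zero_pow (by omega)]
    linear_combination ((k + 1 : ℝ) / (k + 2)) ^ 2 * ih

theorem succ_mul_cosMoment (k : ℕ) : (k + 1 : ℝ) * cosMoment (k + 1) = k * cosMoment (k - 1) := by
  cases k with
  | zero => simp [cosMoment_one]
  | succ k =>
    rw [cosMoment_add_two]
    push_cast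
    have : (k : ℝ) + 2 ≠ 0 := by positivity
    field_simp
    ring

/-- The truncated generating function of the moments. -/
noncomputable def momentSum (K : ℕ) (x : ℝ) : ℝ := ∑ k ∈ Finset.range (K + 1), cosMoment k * x ^ k

/-- The truncated logarithmic generating function of the moments. -/
noncomputable def logMomentSum (K : ℕ) (x : ℝ) : ℝ :=
  ∑ k ∈ Finset.range K, cosMoment (k + 1) * x ^ (k + 1) / (k + 1)

theorem hasDerivAt_momentSum (K : ℕ) (x : ℝ) : HasDerivAt (momentSum K)
    (∑ k ∈ Finset.range K, cosMoment (k + 1) * ((k + 1) * x ^ k)) x := by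
  have : momentSum K = fun x => ∑ k ∈ Finset.range K, cosMoment (k + 1) * x ^ (k + 1) + 1 := by
    funext x
    rw [momentSum, Finset.sum_range_succ', cosMoment_zero]
    simp
  rw [this]
  refine (HasDerivAt.fun_sum fun k _ => ?_).add_const 1
  have := (hasDerivAt_pow (k + 1) x).const_mul (cosMoment (k + 1))
  simpa using this

theorem hasDerivAt_logMomentSum (K : ℕ) (x : ℝ) : HasDerivAt (logMomentSum K)
    (∑ k ∈ Finset.range K, cosMoment (k + 1) * x ^ k) x := by
  refine HasDerivAt.fun_sum fun k _ => ?_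
  have := ((hasDerivAt_pow (k + 1) x).const_mul (cosMoment (k + 1))).div_const ((k : ℝ) + 1)
  have hk : (k : ℝ) + 1 ≠ 0 := by positivity
  have h2 : cosMoment (k + 1) * (((k + 1 : ℕ) : ℝ) * x ^ (k + 1 - 1)) / ((k : ℝ) + 1) =
      cosMoment (k + 1) * x ^ k := by
    push_cast
    field_simp
  rwa [h2] at this

/-- The full series is y = (1 − x²)^(−1/2), which solves x y = (1 − x²) y'. Truncation leaves a
remainder that is nonnegative for x ≥ 0. -/
theorem momentSum_ode (K : ℕ) (x : ℝ) : x * momentSum K x -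
    (1 - x ^ 2) * (∑ k ∈ Finset.range K, cosMoment (k + 1) * ((k + 1) * x ^ k)) =
      (K + 1) * cosMoment K * x ^ (K + 1) + K * cosMoment (K - 1) * x ^ K := by
  induction K with
  | zero => simp [momentSum, cosMoment_zero]
  | succ K ih =>
    have h1 : momentSum (K + 1) x = momentSum K x + cosMoment (K + 1) * x ^ (K + 1) := by
      rw [momentSum, Finset.sum_range_succ, momentSum]
    rw [h1, Finset.sum_range_succ, Nat.add_sub_cancel]
    have h2 := succ_mul_cosMoment K
    push_cast
    linear_combination ih - x ^ K * h2

/-- With x = cos θ the derivative of the left side is the remainder of the differential equation,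
hence nonnegative; at θ = π/2 the value is 1. -/
theorem momentSum_mul_sin_le {K : ℕ} {θ : ℝ} (hθ : θ ∈ Icc 0 (π / 2)) :
    momentSum K (cos θ) * sin θ ≤ 1 := by
  have hd : ∀ θ, HasDerivAt (fun θ => momentSum K (cos θ) * sin θ)
      ((∑ k ∈ Finset.range K, cosMoment (k + 1) * ((k + 1) * cos θ ^ k)) * (-sin θ) * sin θ +
        momentSum K (cos θ) * cos θ) θ := fun θ =>
    ((hasDerivAt_momentSum K (cos θ)).comp θ (hasDerivAt_cos θ)).mul (hasDerivAt_sin θ)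
  have hmono : MonotoneOn (fun θ => momentSum K (cos θ) * sin θ) (Icc 0 (π / 2)) := by
    refine monotoneOn_of_deriv_nonneg (convex_Icc _ _)
      (fun θ _ => (hd θ).continuousAt.continuousWithinAt)
      (fun θ _ => (hd θ).differentiableAt.differentiableWithinAt) fun θ hθ => ?_
    rw [interior_Icc] at hθ
    rw [(hd θ).deriv]
    have hode := momentSum_ode K (cos θ)
    have hc : 0 ≤ cos θ := cos_nonneg_of_mem_Icc ⟨by linarith [hθ.1, pi_pos], hθ.2.le⟩
    have h1 := cosMoment_nonneg K
    have h2 := cosMoment_nonneg (K - 1)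
    have hnn : 0 ≤ (K + 1 : ℝ) * cosMoment K * cos θ ^ (K + 1) +
      K * cosMoment (K - 1) * cos θ ^ K := by positivity
    rw [← hode, ← sin_sq] at hnn
    linarith
  have := hmono hθ (right_mem_Icc.2 (by positivity)) hθ.2
  simp only [cos_pi_div_two, sin_pi_div_two, mul_one] at this
  refine this.trans (le_of_eq ?_)
  rw [momentSum, Finset.sum_range_succ', cosMoment_zero]
  simp

/-- The right side is the sum of the full logarithmic series at x = cos θ. The difference of the two
sides is monotone in θ by the bound on the truncated moment series, and it vanishes at π/2, so no
limit of series is needed. -/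
theorem logMomentSum_cos_le {K : ℕ} {θ : ℝ} (hθ : θ ∈ Icc 0 (π / 2)) :
    logMomentSum K (cos θ) ≤ -log ((1 + sin θ) / 2) := by
  have hs : ∀ θ ∈ Icc 0 (π / 2), 0 < 1 + sin θ := fun θ hθ => by
    linarith [sin_nonneg_of_nonneg_of_le_pi hθ.1 (by linarith [hθ.2, pi_pos])]
  have hd : ∀ θ ∈ Icc 0 (π / 2), HasDerivAt
      (fun θ => logMomentSum K (cos θ) + log ((1 + sin θ) / 2))
      ((∑ k ∈ Finset.range K, cosMoment (k + 1) * cos θ ^ k) * (-sin θ) +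
        cos θ / 2 / ((1 + sin θ) / 2)) θ := fun θ hθ =>
    ((hasDerivAt_logMomentSum K (cos θ)).comp θ (hasDerivAt_cos θ)).add
      ((((hasDerivAt_sin θ).const_add 1).div_const 2).log (by linarith [hs θ hθ]))
  have hmono : MonotoneOn (fun θ => logMomentSum K (cos θ) + log ((1 + sin θ) / 2))
      (Icc 0 (π / 2)) := by
    refine monotoneOn_of_deriv_nonneg (convex_Icc _ _)
      (fun θ hθ => (hd θ hθ).continuousAt.continuousWithinAt)
      (fun θ hθ => (hd θ (interior_subset hθ)).differentiableAt.differentiableWithinAt)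
      fun θ hθ => ?_
    have hθ' := interior_subset hθ
    rw [interior_Icc] at hθ
    rw [(hd θ hθ').deriv]
    set P := ∑ k ∈ Finset.range K, cosMoment (k + 1) * cos θ ^ k with hP
    have hc : 0 < cos θ := cos_pos_of_mem_Ioo ⟨by linarith [hθ.1, pi_pos], hθ.2⟩
    have h1 : cos θ * P = momentSum K (cos θ) - 1 := by
      rw [momentSum, Finset.sum_range_succ', cosMoment_zero, hP, Finset.mul_sum]
      simp only [pow_zero, mul_one, add_sub_cancel_right]
      refine Finset.sum_congr rfl fun k _ => ?_
      ring
    have h2 := momentSum_mul_sin_le (K := K) hθ'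
    have h3 := hs θ hθ'
    have h4 : P * sin θ * (1 + sin θ) ≤ cos θ := by
      refine le_of_mul_le_mul_left ?_ hc
      have h5 : cos θ * cos θ = (1 - sin θ) * (1 + sin θ) := by
        linear_combination sin_sq_add_cos_sq θ
      rw [h5, show cos θ * (P * sin θ * (1 + sin θ)) = (cos θ * P * sin θ) * (1 + sin θ) by ring,
        h1]
      refine mul_le_mul_of_nonneg_right ?_ h3.le
      linarith
    have h6 : P * sin θ ≤ cos θ / (1 + sin θ) := (le_div_iff₀ h3).2 h4
    have h7 : cos θ / 2 / ((1 + sin θ) / 2) = cos θ / (1 + sin θ) := by field_simp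
    rw [h7]
    linarith
  have := hmono hθ (right_mem_Icc.2 (by positivity)) hθ.2
  simp only [cos_pi_div_two, sin_pi_div_two] at this
  have h0 : logMomentSum K 0 = 0 := by simp [logMomentSum]
  rw [h0, show ((1 : ℝ) + 1) / 2 = 1 by norm_num, log_one] at this
  linarith

theorem continuous_logMomentSum (K : ℕ) : Continuous (logMomentSum K) := by
  unfold logMomentSum
  fun_prop

/-- Write one of the two factors of each squared moment as an integral over [0, π/2]. The sum
becomes the integral of the truncated logarithmic series, which is bounded pointwise. -/
theorem sum_cosMoment_sq_le (K : ℕ) :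
    ∑ k ∈ Finset.range K, cosMoment (k + 1) ^ 2 / (k + 1) ≤ log 4 - 4 * catalanC / π := by
  have h1 : ∑ k ∈ Finset.range K, cosMoment (k + 1) ^ 2 / (k + 1) =
      2 / π * ∫ θ in (0 : ℝ)..π / 2, logMomentSum K (cos θ) := by
    simp only [logMomentSum]
    rw [intervalIntegral.integral_finsetSum, Finset.mul_sum]
    · refine Finset.sum_congr rfl fun k _ => ?_
      rw [intervalIntegral.integral_div, intervalIntegral.integral_const_mul, sq,
        cosMoment_mul_self]
      ring
    · intro k _
      refine Continuous.intervalIntegrable ?_ _ _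
      fun_prop
  have h2 : ∫ θ in (0 : ℝ)..π / 2, logMomentSum K (cos θ) ≤
      ∫ θ in (0 : ℝ)..π / 2, -log ((1 + sin θ) / 2) := by
    refine intervalIntegral.integral_mono_on (by positivity) ?_ ?_
      fun θ hθ => logMomentSum_cos_le hθ
    · exact ((continuous_logMomentSum K).comp continuous_cos).intervalIntegrable _ _
    · refine ContinuousOn.intervalIntegrable ?_
      rw [uIcc_of_le (by positivity)]
      refine (ContinuousOn.log (by fun_prop) fun θ hθ => ?_).neg
      linarith [sin_nonneg_of_nonneg_of_le_pi hθ.1 (by linarith [hθ.2, pi_pos])]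
  rw [intervalIntegral.integral_neg, integral_log_one_add_sin] at h2
  rw [h1, show (4 : ℝ) = 2 ^ 2 by norm_num, Real.log_pow]
  calc 2 / π * ∫ θ in (0 : ℝ)..π / 2, logMomentSum K (cos θ)
      ≤ 2 / π * -(2 * catalanC - π * log 2) := by gcongr
    _ = _ := by
      have := pi_ne_zero
      push_cast
      field_simp
      ring

end GridGraph

/-! ### Walk counts, the spectrum of the face graph and bounds for the determinant -/

namespace GridGraph

open Real Set Filter Topology Matrix

/-! ### Counting lattice walks -/

/-- The number of `k`-step walks from `0` to `j` on `ℤ`, as a Fourier integral. -/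
noncomputable def walkCount (k : ℕ) (j : ℤ) : ℝ :=
  1 / π * ∫ θ in (0 : ℝ)..π, (2 * cos θ) ^ k * cos (j * θ)

theorem walkCount_zero_zero : walkCount 0 0 = 1 := by
  simp [walkCount, pi_ne_zero]

theorem walkCount_zero {j : ℤ} (hj : j ≠ 0) : walkCount 0 j = 0 := by
  have hj' : (j : ℝ) ≠ 0 := by exact_mod_cast hj
  simp only [walkCount, pow_zero, one_mul]
  rw [intervalIntegral.integral_comp_mul_left (fun x => cos x) hj', integral_cos]
  simp [sin_int_mul_pi]

theorem walkCount_succ (k : ℕ) (j : ℤ) :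
    walkCount (k + 1) j = walkCount k (j - 1) + walkCount k (j + 1) := by
  simp only [walkCount]
  rw [← mul_add, ← intervalIntegral.integral_add]
  · congr 1
    refine intervalIntegral.integral_congr fun θ _ => ?_
    have h1 : cos (((j - 1 : ℤ) : ℝ) * θ) = cos (j * θ) * cos θ + sin (j * θ) * sin θ := by
      rw [← cos_sub]; congr 1; push_cast; ring
    have h2 : cos (((j + 1 : ℤ) : ℝ) * θ) = cos (j * θ) * cos θ - sin (j * θ) * sin θ := by
      rw [← cos_add]; congr 1; push_cast; ring
    simp only [h1, h2]
    ring
  · exact Continuous.intervalIntegrable (by fun_prop) _ _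
  · exact Continuous.intervalIntegrable (by fun_prop) _ _

theorem walkCount_nonneg (k : ℕ) : ∀ j, 0 ≤ walkCount k j := by
  induction k with
  | zero =>
    intro j
    rcases eq_or_ne j 0 with rfl | hj
    · rw [walkCount_zero_zero]; exact zero_le_one
    · rw [walkCount_zero hj]
  | succ k ih =>
    intro j
    rw [walkCount_succ]
    exact add_nonneg (ih _) (ih _)

theorem walkCount_at_zero (k : ℕ) : walkCount k 0 = 2 ^ k * cosMoment k := by
  simp only [walkCount, cosMoment, Int.cast_zero, zero_mul, cos_zero, mul_one, mul_pow,
    intervalIntegral.integral_const_mul]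
  ring

variable {D : Set (ℤ × ℤ)} [Fintype D]

theorem cellAdj_eq (p q : D) : cellAdj D p q =
    (if (q : ℤ × ℤ) = (p.1.1 + 1, p.1.2) then 1 else 0) +
    (if (q : ℤ × ℤ) = (p.1.1 - 1, p.1.2) then 1 else 0) +
    (if (q : ℤ × ℤ) = (p.1.1, p.1.2 + 1) then 1 else 0) +
    (if (q : ℤ × ℤ) = (p.1.1, p.1.2 - 1) then 1 else 0) := by
  obtain ⟨⟨a, b⟩, hp⟩ := p
  obtain ⟨⟨c, d⟩, hq⟩ := q
  simp only [cellAdj, squareLattice_adj_iff, Prod.mk.injEq]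
  by_cases h1 : c = a + 1 ∧ d = b
  · obtain ⟨rfl, rfl⟩ := h1; simp; omega
  by_cases h2 : c = a - 1 ∧ d = b
  · obtain ⟨rfl, rfl⟩ := h2; simp; omega
  by_cases h3 : c = a ∧ d = b + 1
  · obtain ⟨rfl, rfl⟩ := h3; simp; omega
  by_cases h4 : c = a ∧ d = b - 1
  · obtain ⟨rfl, rfl⟩ := h4; simp; omega
  rw [if_neg h1, if_neg h2, if_neg h3, if_neg h4, if_neg (by omega)]
  simp

theorem sum_cellAdj_mul (p : D) (w : ℤ × ℤ → ℝ) (hw : ∀ q ∉ D, w q = 0) :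
    ∑ q, cellAdj D p q * w q = w (p.1.1 + 1, p.1.2) + w (p.1.1 - 1, p.1.2) +
      w (p.1.1, p.1.2 + 1) + w (p.1.1, p.1.2 - 1) := by
  rw [← sum_subtype_mul_ite (S := D) w _ (hw (p.1.1 + 1, p.1.2)),
    ← sum_subtype_mul_ite (S := D) w _ (hw (p.1.1 - 1, p.1.2)),
    ← sum_subtype_mul_ite (S := D) w _ (hw (p.1.1, p.1.2 + 1)),
    ← sum_subtype_mul_ite (S := D) w _ (hw (p.1.1, p.1.2 - 1))]
  simp only [← Finset.sum_add_distrib]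
  refine Finset.sum_congr rfl fun q _ => ?_
  rw [cellAdj_eq]
  ring

open Classical in
theorem sum_cellAdj_mul_le (p : D) (w : ℤ × ℤ → ℝ) (hw : ∀ q, 0 ≤ w q) :
    ∑ q, cellAdj D p q * w q ≤ w (p.1.1 + 1, p.1.2) + w (p.1.1 - 1, p.1.2) +
      w (p.1.1, p.1.2 + 1) + w (p.1.1, p.1.2 - 1) := by
  have h := sum_cellAdj_mul p (fun q => if q ∈ D then w q else 0) (fun q hq => if_neg hq)
  have h1 : ∀ q, (if q ∈ D then w q else 0) ≤ w q := fun q => by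
    split_ifs
    · exact le_rfl
    · exact hw q
  have h2 : ∑ q : D, cellAdj D p q * (if (q : ℤ × ℤ) ∈ D then w q else 0) =
      ∑ q, cellAdj D p q * w q :=
    Finset.sum_congr rfl fun q _ => by rw [if_pos q.2]
  rw [← h2, h]
  exact add_le_add (add_le_add (add_le_add (h1 _) (h1 _)) (h1 _)) (h1 _)

theorem cellAdj_comm (p q : D) : cellAdj D p q = cellAdj D q p := by
  unfold cellAdj
  rw [squareLattice.adj_comm]

theorem isHermitian_cellAdj : (cellAdj D).IsHermitian :=
  Matrix.IsHermitian.ext fun p q => cellAdj_comm q p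

theorem cellAdj_nonneg (p q : D) : 0 ≤ cellAdj D p q := by
  simp only [cellAdj]
  split_ifs <;> norm_num

variable [DecidableEq D]

/-- In the coordinates x + y and x − y a step of ℤ² is a pair of independent steps ±1, so walks on
ℤ² are counted by a product of two one-dimensional counts. Walks inside `D` are among them. -/
theorem cellAdj_pow_le (k : ℕ) (p q : D) : (cellAdj D ^ k) p q ≤
    walkCount k (q.1.1 - p.1.1 + (q.1.2 - p.1.2)) *
      walkCount k (q.1.1 - p.1.1 - (q.1.2 - p.1.2)) := by
  induction k generalizing q with
  | zero =>
    rw [pow_zero, Matrix.one_apply]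
    split_ifs with h
    · subst h
      simp [walkCount_zero_zero]
    · exact mul_nonneg (walkCount_nonneg _ _) (walkCount_nonneg _ _)
  | succ k ih =>
    rw [pow_succ, Matrix.mul_apply]
    set w : ℤ × ℤ → ℝ := fun r => walkCount k (r.1 - p.1.1 + (r.2 - p.1.2)) *
      walkCount k (r.1 - p.1.1 - (r.2 - p.1.2)) with hw
    calc ∑ r, (cellAdj D ^ k) p r * cellAdj D r q ≤ ∑ r, cellAdj D q r * w r := by
          refine Finset.sum_le_sum fun r _ => ?_
          rw [mul_comm, cellAdj_comm r q]
          exact mul_le_mul_of_nonneg_left (ih r) (cellAdj_nonneg _ _)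
      _ ≤ _ := sum_cellAdj_mul_le q w fun r =>
          mul_nonneg (walkCount_nonneg _ _) (walkCount_nonneg _ _)
      _ = _ := by
          obtain ⟨⟨a, b⟩, hp⟩ := p
          obtain ⟨⟨c, d⟩, hq⟩ := q
          simp only [hw, walkCount_succ]
          rw [show c + 1 - a + (d - b) = c - a + (d - b) + 1 by ring,
            show c + 1 - a - (d - b) = c - a - (d - b) + 1 by ring,
            show c - 1 - a + (d - b) = c - a + (d - b) - 1 by ring,
            show c - 1 - a - (d - b) = c - a - (d - b) - 1 by ring,
            show c - a + (d + 1 - b) = c - a + (d - b) + 1 by ring,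
            show c - a - (d + 1 - b) = c - a - (d - b) - 1 by ring,
            show c - a + (d - 1 - b) = c - a + (d - b) - 1 by ring,
            show c - a - (d - 1 - b) = c - a - (d - b) + 1 by ring]
          ring

theorem trace_cellAdj_pow_le (k : ℕ) :
    (cellAdj D ^ k).trace ≤ Fintype.card D * (4 ^ k * cosMoment k ^ 2) := by
  have : ∀ p : D, (cellAdj D ^ k) p p ≤ 4 ^ k * cosMoment k ^ 2 := fun p => by
    refine (cellAdj_pow_le k p p).trans (le_of_eq ?_)
    simp only [sub_self, add_zero, walkCount_at_zero]
    rw [show (4 : ℝ) = 2 * 2 by norm_num, mul_pow]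
    ring
  calc (cellAdj D ^ k).trace ≤ ∑ _p : D, 4 ^ k * cosMoment k ^ 2 :=
        Finset.sum_le_sum fun p _ => this p
    _ = _ := by simp

/-! ### The spectrum of the cell graph -/

open Classical in
-- Maximum principle: at a topmost cell among those maximizing |v|, the upper neighbour contributes
-- strictly less than the maximum, so the sum over four neighbours is less than 4 |v i|.
theorem abs_lt_four_of_mulVec_eq {μ : ℝ} {v : D → ℝ} (hv : v ≠ 0) (h : cellAdj D *ᵥ v = μ • v) :
    |μ| < 4 := by
  obtain ⟨i₀, hi₀⟩ := Function.ne_iff.1 hv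
  obtain ⟨i₁, -, hi₁⟩ := Finset.exists_max_image Finset.univ (fun i => |v i|) ⟨i₀, Finset.mem_univ _⟩
  obtain ⟨i, hi, himax⟩ := Finset.exists_max_image
    (Finset.univ.filter fun i => |v i| = |v i₁|) (fun i => i.1.2)
    ⟨i₁, by simp⟩
  have hiv : |v i| = |v i₁| := (Finset.mem_filter.1 hi).2
  have hle : ∀ j, |v j| ≤ |v i| := fun j => by rw [hiv]; exact hi₁ j (Finset.mem_univ _)
  have hpos : 0 < |v i| := (abs_pos.2 hi₀).trans_le (hle i₀)
  set w : ℤ × ℤ → ℝ := fun q => if hq : q ∈ D then |v ⟨q, hq⟩| else 0 with hw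
  have hwle : ∀ q, w q ≤ |v i| := fun q => by
    simp only [hw]
    split_ifs with hq
    · exact hle _
    · exact hpos.le
  have htop : w (i.1.1, i.1.2 + 1) < |v i| := by
    simp only [hw]
    split_ifs with hq
    · refine lt_of_le_of_ne (hle _) fun heq => ?_
      have := himax ⟨_, hq⟩ (by simp [heq, hiv])
      simp only at this
      omega
    · exact hpos
  have hsum := sum_cellAdj_mul i w fun q hq => dif_neg hq
  have h1 : |μ| * |v i| ≤ ∑ q, cellAdj D i q * w q := by
    have h2 : μ * v i = ∑ q, cellAdj D i q * v q := (congrFun h i).symm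
    rw [← abs_mul, h2]
    refine (Finset.abs_sum_le_sum_abs _ _).trans (le_of_eq ?_)
    refine Finset.sum_congr rfl fun q _ => ?_
    rw [abs_mul, abs_of_nonneg (cellAdj_nonneg _ _), hw]
    simp
  have h3 : |μ| * |v i| < 4 * |v i| := by
    rw [hsum] at h1
    linarith [hwle (i.1.1 + 1, i.1.2), hwle (i.1.1 - 1, i.1.2), hwle (i.1.1, i.1.2 - 1)]
  exact lt_of_mul_lt_mul_right h3 hpos.le

theorem abs_eigenvalues_lt_four (i : D) : |(isHermitian_cellAdj (D := D)).eigenvalues i| < 4 := by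
  refine abs_lt_four_of_mulVec_eq (v := ⇑(isHermitian_cellAdj (D := D)).eigenvectorBasis i) ?_
    (isHermitian_cellAdj.mulVec_eigenvectorBasis i)
  intro h
  exact isHermitian_cellAdj.eigenvectorBasis.orthonormal.ne_zero i (by
    ext j
    exact congrFun h j)

theorem _root_.Matrix.IsHermitian.trace_pow {n : Type*} [Fintype n] [DecidableEq n]
    {A : Matrix n n ℝ} (hA : A.IsHermitian) (k : ℕ) :
    (A ^ k).trace = ∑ i, hA.eigenvalues i ^ k := by
  conv_lhs => rw [hA.spectral_theorem, ← map_pow, Matrix.diagonal_pow,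
    Unitary.conjStarAlgAut_apply, Matrix.trace_mul_cycle]
  simp [Matrix.trace]

theorem det_four_sub_cellAdj : ((4 : ℝ) • 1 - cellAdj D).det =
    ∏ i, (4 - (isHermitian_cellAdj (D := D)).eigenvalues i) := by
  have h := Matrix.eval_charpoly (cellAdj D) 4
  rw [isHermitian_cellAdj.charpoly_eq, Polynomial.eval_prod] at h
  simp only [Polynomial.eval_sub, Polynomial.eval_X, Polynomial.eval_C] at h
  rw [Matrix.smul_one_eq_diagonal]
  exact h.symm

theorem det_four_sub_cellAdj_pos : 0 < ((4 : ℝ) • 1 - cellAdj D).det := by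
  rw [det_four_sub_cellAdj]
  exact Finset.prod_pos fun i _ => by
    linarith [(abs_lt.1 (abs_eigenvalues_lt_four i)).2]

theorem log_det_eq : log ((4 : ℝ) • 1 - cellAdj D).det = Fintype.card D * log 4 +
    ∑ i, log (1 - (isHermitian_cellAdj (D := D)).eigenvalues i / 4) := by
  have h0 : ∀ i, 0 < 1 - (isHermitian_cellAdj (D := D)).eigenvalues i / 4 := fun i => by
    linarith [(abs_lt.1 (abs_eigenvalues_lt_four i)).2]
  rw [det_four_sub_cellAdj, Real.log_prod fun i _ => by
    linarith [(abs_lt.1 (abs_eigenvalues_lt_four i)).2, h0 i]]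
  have h1 : ∀ i, log (4 - (isHermitian_cellAdj (D := D)).eigenvalues i) =
      log 4 + log (1 - (isHermitian_cellAdj (D := D)).eigenvalues i / 4) := fun i => by
    rw [← Real.log_mul four_ne_zero (h0 i).ne']
    congr 1
    ring
  simp [h1, Finset.sum_add_distrib]

/-- Apply log(1 − x) ≤ −x to each eigenvalue over 4; the linear terms add up to the trace, which is
zero. -/
theorem log_det_le : log ((4 : ℝ) • 1 - cellAdj D).det ≤ Fintype.card D * log 4 := by
  rw [log_det_eq]
  have htr : ∑ i, (isHermitian_cellAdj (D := D)).eigenvalues i = 0 := by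
    have := (isHermitian_cellAdj (D := D)).trace_pow 1
    simp only [pow_one] at this
    rw [← this, Matrix.trace]
    refine Finset.sum_eq_zero fun p _ => ?_
    simp [cellAdj]
  have : ∑ i, log (1 - (isHermitian_cellAdj (D := D)).eigenvalues i / 4) ≤
      ∑ i, -((isHermitian_cellAdj (D := D)).eigenvalues i / 4) := by
    refine Finset.sum_le_sum fun i _ => ?_
    have := Real.log_le_sub_one_of_pos (x := 1 - (isHermitian_cellAdj (D := D)).eigenvalues i / 4)
      (by linarith [(abs_lt.1 (abs_eigenvalues_lt_four i)).2])
    linarith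
  rw [Finset.sum_neg_distrib, ← Finset.sum_div, htr] at this
  linarith

/-- Expand −log(1 − a/4) in powers of each eigenvalue a, where |a| < 4. The power sums are traces,
bounded by closed walk counts, so every partial sum obeys the moment estimate. -/
theorem le_log_det :
    Fintype.card D * (4 * catalanC / π) ≤ log ((4 : ℝ) • 1 - cellAdj D).det := by
  rw [log_det_eq]
  set a := (isHermitian_cellAdj (D := D)).eigenvalues with ha
  have hs : HasSum (fun k : ℕ => ∑ i, (a i / 4) ^ (k + 1) / (k + 1)) (∑ i, -log (1 - a i / 4)) := by
    refine hasSum_sum fun i _ => hasSum_pow_div_log_of_abs_lt_one ?_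
    rw [abs_div, abs_of_pos (four_pos (α := ℝ))]
    linarith [abs_eigenvalues_lt_four i]
  have hle : ∑ i, -log (1 - a i / 4) ≤ Fintype.card D * (log 4 - 4 * catalanC / π) := by
    refine le_of_tendsto' hs.tendsto_sum_nat fun K => ?_
    calc ∑ k ∈ Finset.range K, ∑ i, (a i / 4) ^ (k + 1) / ((k : ℝ) + 1)
        ≤ ∑ k ∈ Finset.range K, Fintype.card D * (cosMoment (k + 1) ^ 2 / (k + 1)) := by
          refine Finset.sum_le_sum fun k _ => ?_
          rw [← Finset.sum_div, ← mul_div_assoc]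
          gcongr
          simp only [div_pow]
          rw [← Finset.sum_div, ha, ← isHermitian_cellAdj.trace_pow, div_le_iff₀ (by positivity)]
          refine (trace_cellAdj_pow_le (k + 1)).trans (le_of_eq ?_)
          ring
      _ ≤ _ := by
          rw [← Finset.mul_sum]
          exact mul_le_mul_of_nonneg_left (sum_cosMoment_sq_le K) (Nat.cast_nonneg _)
  rw [Finset.sum_neg_distrib] at hle
  linarith

end GridGraph

/-! ### Counting edges over the districts and conclusion -/

namespace GridGraph

open Real Set

theorem gridArea_mul_le_log_numSpanningTrees {G : squareLattice.Subgraph}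
    (hG : IsSimpleGridGraph G) : 0 < (numSpanningTrees G : ℝ) ∧
      gridArea G * log bulkBase ≤ log (numSpanningTrees G) ∧
      log (numSpanningTrees G) ≤ gridArea G * log 4 := by
  classical
  have := (finite_gridFaces (verts_finite hG)).fintype
  have hcard : (gridArea G : ℝ) = Fintype.card (gridFaces G) := by
    rw [gridArea, ← Nat.card_coe_set_eq, Nat.card_eq_fintype_card]
  rw [numSpanningTrees_eq_det hG, hcard, bulkBase, Real.log_exp]
  exact ⟨det_four_sub_cellAdj_pos, le_log_det, log_det_le⟩

/-- Choosing the rightward or upward orientation of each cut edge allows it to be counted alongside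
the edges in Euler's formula. -/
theorem ncard_cutEdges (G : squareLattice.Subgraph) {K : ℕ} (V : Fin K → Set (ℤ × ℤ)) :
    (cutEdges G V).ncard =
      {e ∈ orientedEdges G | ∃ i j, i ≠ j ∧ e.1 ∈ V i ∧ edgeHead e ∈ V j}.ncard := by
  rw [← Set.ncard_image_of_injective _ edge_injective]
  congr 1
  ext e
  constructor
  · rintro ⟨he, i, j, hij, p, hp, q, hq, rfl⟩
    obtain ⟨e, ⟨rfl, rfl⟩ | ⟨rfl, rfl⟩⟩ := exists_edge_of_adj (G.edgeSet_subset he)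
    · exact ⟨e, ⟨he, i, j, hij, hp, hq⟩, rfl⟩
    · exact ⟨e, ⟨SimpleGraph.Subgraph.Adj.symm he, j, i, hij.symm, hq, hp⟩, Sym2.eq_swap⟩
  · rintro ⟨e, ⟨he, i, j, hij, hi, hj⟩, rfl⟩
    exact ⟨he, i, j, hij, _, hi, _, hj, rfl⟩

/-- The edges of `G` are those of the districts together with the cut edges. -/
theorem ncard_orientedEdges_partition {G : squareLattice.Subgraph} (hfin : G.verts.Finite)
    {K : ℕ} {V : Fin K → Set (ℤ × ℤ)} (hdisj : ∀ i j : Fin K, i ≠ j → Disjoint (V i) (V j))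
    (hcover : (⋃ i, V i) = G.verts) :
    (orientedEdges G).ncard =
      ∑ i, (orientedEdges (G.induce (V i))).ncard + (cutEdges G V).ncard := by
  have hE := finite_orientedEdges hfin
  have hsub : ∀ i, orientedEdges (G.induce (V i)) ⊆ orientedEdges G := fun i e he => he.2.2
  have hunion : orientedEdges G = (⋃ i, orientedEdges (G.induce (V i))) ∪
      {e ∈ orientedEdges G | ∃ i j, i ≠ j ∧ e.1 ∈ V i ∧ edgeHead e ∈ V j} := by
    ext e
    constructor
    · intro he
      have h1 := G.edge_vert he
      have h2 := SimpleGraph.Subgraph.Adj.snd_mem he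
      rw [← hcover, mem_iUnion] at h1 h2
      obtain ⟨i, hi⟩ := h1
      obtain ⟨j, hj⟩ := h2
      by_cases hij : i = j
      · subst hij
        exact Or.inl (mem_iUnion.2 ⟨i, hi, hj, he⟩)
      · exact Or.inr ⟨he, i, j, hij, hi, hj⟩
    · rintro (he | he)
      · obtain ⟨i, hi⟩ := mem_iUnion.1 he
        exact hsub i hi
      · exact he.1
  have hd : Disjoint (⋃ i, orientedEdges (G.induce (V i)))
      {e ∈ orientedEdges G | ∃ i j, i ≠ j ∧ e.1 ∈ V i ∧ edgeHead e ∈ V j} := by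
    rw [Set.disjoint_left]
    rintro e he ⟨-, i, j, hij, hi, hj⟩
    obtain ⟨k, hk⟩ := mem_iUnion.1 he
    have hki : k = i := by
      by_contra hne
      exact Set.disjoint_left.1 (hdisj k i hne) hk.1 hi
    have hkj : k = j := by
      by_contra hne
      exact Set.disjoint_left.1 (hdisj k j hne) hk.2.1 hj
    exact hij (hki.symm.trans hkj)
  rw [ncard_cutEdges]
  conv_lhs => rw [hunion]
  rw [Set.ncard_union_eq hd (hE.subset (iUnion_subset hsub)) (hE.subset (sep_subset _ _))]
  congr 1
  rw [Set.ncard_iUnion_of_finite (fun i => hE.subset (hsub i)), finsum_eq_sum_of_fintype]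
  intro i j hij
  rw [Function.onFun, Set.disjoint_left]
  exact fun e he he' => Set.disjoint_left.1 (hdisj i j hij) he.1 he'.1

theorem ncard_verts_partition {G : squareLattice.Subgraph} (hfin : G.verts.Finite)
    {K : ℕ} {V : Fin K → Set (ℤ × ℤ)} (hdisj : ∀ i j : Fin K, i ≠ j → Disjoint (V i) (V j))
    (hcover : (⋃ i, V i) = G.verts) : G.verts.ncard = ∑ i, (V i).ncard := by
  rw [← hcover, Set.ncard_iUnion_of_finite (fun i => ?_), finsum_eq_sum_of_fintype]
  · exact fun i j hij => hdisj i j hij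
  · exact hfin.subset (hcover ▸ subset_iUnion V i)

end GridGraph

theorem proposition7p1 (G : squareLattice.Subgraph) (hG : IsSimpleGridGraph G)
    (K : ℕ) (V : Fin K → Set (ℤ × ℤ))
    (hdisj : ∀ i j : Fin K, i ≠ j → Disjoint (V i) (V j))
    (hcover : (⋃ i, V i) = G.verts)
    (hdistrict : ∀ i, IsSimpleGridGraph (G.induce (V i))) :
    ((cutEdges G V).ncard : ℤ) =
        (gridArea G : ℤ) + (K : ℤ) - 1 - ∑ i, (gridArea (G.induce (V i)) : ℤ) ∧
      ((gridArea G : ℝ) + (K : ℝ) - 1)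
          - 1 / Real.log bulkBase * Real.log (∏ i, (numSpanningTrees (G.induce (V i)) : ℝ))
        ≤ ((cutEdges G V).ncard : ℝ) ∧
      ((cutEdges G V).ncard : ℝ) ≤
        ((gridArea G : ℝ) + (K : ℝ) - 1)
          - 1 / Real.log 4 * Real.log (∏ i, (numSpanningTrees (G.induce (V i)) : ℝ)) := by
  have hfin := GridGraph.verts_finite hG
  have hcut : ((cutEdges G V).ncard : ℤ) =
      (gridArea G : ℤ) + (K : ℤ) - 1 - ∑ i, (gridArea (G.induce (V i)) : ℤ) := by
    have h1 := GridGraph.euler_formula hG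
    -- Summed over the districts, Euler's formula contributes the constant `K`, against 1 for `G`.
    have h2 : ∑ i, (gridArea (G.induce (V i)) + (V i).ncard) =
        ∑ i, ((GridGraph.orientedEdges (G.induce (V i))).ncard + 1) :=
      Finset.sum_congr rfl fun i _ => GridGraph.euler_formula (hdistrict i)
    have h3 := GridGraph.ncard_orientedEdges_partition hfin hdisj hcover
    have h4 := GridGraph.ncard_verts_partition hfin hdisj hcover
    simp only [Finset.sum_add_distrib, Finset.sum_const, Finset.card_univ, Fintype.card_fin,
      smul_eq_mul, mul_one] at h2
    rw [← Nat.cast_sum]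
    omega
  have hcutR : ((cutEdges G V).ncard : ℝ) =
      (gridArea G : ℝ) + (K : ℝ) - 1 - ∑ i, (gridArea (G.induce (V i)) : ℝ) := by
    exact_mod_cast hcut
  have hb := fun i => GridGraph.gridArea_mul_le_log_numSpanningTrees (hdistrict i)
  rw [Real.log_prod fun i _ => (hb i).1.ne', hcutR]
  have hbulk : 0 < Real.log bulkBase := by
    rw [bulkBase, Real.log_exp]
    have := GridGraph.catalanC_pos
    positivity
  have hfour : 0 < Real.log 4 := Real.log_pos (by norm_num)
  refine ⟨hcut, ?_, ?_⟩
  -- By the exact identity, it remains to compare the total area of the districts with the sum of ln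
  -- τ divided by ln b, whose positivity allows clearing the denominator.
  · refine sub_le_sub_left ?_ _
    rw [one_div, inv_mul_eq_div, le_div_iff₀ hbulk, Finset.sum_mul]
    exact Finset.sum_le_sum fun i _ => (hb i).2.1
  · refine sub_le_sub_left ?_ _
    rw [one_div, inv_mul_eq_div, div_le_iff₀ hfour, Finset.sum_mul]
    exact Finset.sum_le_sum fun i _ => (hb i).2.2
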